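/- Let $p$ be an odd prime, let $s,m\ge 1$ and $\nu\ge 2$ be integers, and let $\delta\in\{0,1,2\}$. Let $R$ be the Galois ring of characteristic $p^s$ and cardinality $p^{sm}$ (a finite commutative ring whose zero divisors, $0$ included, form the ideal $pR$), with unit group $R^*$, and let $z\in R^*$ be a non-square. Let $$S=\begin{pmatrix}0&I^{(\nu)}&\\ I^{(\nu)}&0&\\ &&\Delta\end{pmatrix},$$ where $\Delta$ is empty if $\delta=0$, $\Delta=(1)$ or $\Delta=(z)$ if $\delta=1$, and $\Delta=\mathrm{diag}(1,-z)$ if $\delta=2$. For a tuple $\alpha\in R\times\cdots\times R$ ($2\nu+\delta$ factors) with at least one unit coordinate, let $[\alpha]$ be its class up to multiplication by elements of $R^*$. The orthogonal graph $\Gamma^{2\nu+\delta}$ has as vertices the classes $[\alpha]$ with $\alpha S\alpha^{t}=0$; two vertices $[\alpha],[\beta]$ are adjacent if $\alpha S\beta^{t}\in R^*$. Then $\Gamma^{2\nu+\delta}$ is quasi-strongly regular of grade $2$ with parameters $(n,k,\lambda;c_1,c_2)$; that is, it is a connected graph on $n$ vertices, regular of valency $k$, any two adjacent vertices have exactly $\lambda$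 common neighbours, any two distinct non-adjacent vertices have $c_1$ or $c_2$ common neighbours, and $c_1\neq c_2$. Here $$n=\frac{(p^{m\nu}-1)(p^{m(\nu+\delta-1)}+1)\,p^{m(s-1)(2\nu-2+\delta)}}{p^m-1},\qquad k=p^{ms(2\nu-2+\delta)},$$ $$\lambda=(p^m-1)\bigl(1+(\delta-1)p^{m(1-\nu-\delta/2)}\bigr)p^{m(2s\nu-2s-1+s\delta)},$$ $$c_1=(p^m-1)p^{m(s(2\nu-2+\delta)-1)},\qquad c_2=p^{ms(2\nu-2+\delta)}.$$ Moreover, if $s\ge 2$, each of $c_1$ and $c_2$ is the number of common neighbours of some pair of distinct non-adjacent vertices. -/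

import Mathlib

namespace OrthGraph

open scoped Matrix

/-- `R` is a Galois ring of characteristic `p ^ s` and cardinality `p ^ (s * m)`: a finite
commutative ring whose zero divisors (with `0` counted among them) form exactly the principal
ideal generated by `p`. -/
structure IsGaloisRing (p s m : ℕ) (R : Type*) [CommRing R] : Prop where
  finite : Finite R
  charP : CharP R (p ^ s)
  card_eq : Nat.card R = p ^ (s * m)
  zeroDivisors_eq : ((nonZeroDivisors R : Set R))ᶜ = (Ideal.span {(p : R)} : Set R)

section Projective

variable (R : Type*) [CommRing R] (ι : Type*)

/-- Tuples over `R` having at least one unit coordinate. -/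
def UnitTuple : Type _ := {a : ι → R // ∃ i, IsUnit (a i)}

/-- Two tuples are equivalent when they differ by a unit scalar. -/
def unitSetoid : Setoid (UnitTuple R ι) where
  r a b := ∃ u : Rˣ, a.1 = (u : R) • b.1
  iseqv :=
    { refl := fun a => ⟨1, by simp⟩
      symm := by
        rintro a b ⟨u, hu⟩
        exact ⟨u⁻¹, by rw [hu, smul_smul]; simp⟩
      trans := by
        rintro a b c ⟨u, hu⟩ ⟨v, hv⟩
        exact ⟨u * v, by rw [hu, hv, smul_smul]; simp⟩ }

/-- Equivalence classes `[a]` of tuples with a unit coordinate, up to unit scalars. -/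
def ProjPoint : Type _ := Quotient (unitSetoid R ι)

end Projective

section Graph

variable {R : Type*} [CommRing R] {ι : Type*} [Fintype ι]

/-- The bilinear form `a S bᵗ`. -/
def form (S : Matrix ι ι R) (a b : ι → R) : R := a ⬝ᵥ (S *ᵥ b)

theorem form_smul_smul (S : Matrix ι ι R) (u v : R) (a b : ι → R) :
    form S (u • a) (v • b) = u * v * form S a b := by
  simp [form, Matrix.mulVec_smul, smul_dotProduct, dotProduct_smul, smul_eq_mul]
  ring

theorem form_comm {S : Matrix ι ι R} (hS : S.IsSymm) (a b : ι → R) :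
    form S a b = form S b a := by
  unfold form
  rw [Matrix.dotProduct_mulVec, dotProduct_comm, ← Matrix.mulVec_transpose, hS.eq]

/-- `[a]` is isotropic: `a S aᵗ = 0` (independent of the representative). -/
def ProjPoint.IsIsotropic (S : Matrix ι ι R) (x : ProjPoint R ι) : Prop :=
  Quotient.lift (s := unitSetoid R ι) (fun a => form S a.1 a.1 = 0) (by
    rintro a b ⟨u, hu⟩
    simp only [hu, form_smul_smul, eq_iff_iff]
    rw [← Units.val_mul, Units.mul_right_eq_zero]) x

/-- `a S bᵗ` is a unit (independent of the representatives of `[a]` and `[b]`). -/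
def ProjPoint.UnitPairing (S : Matrix ι ι R) (x y : ProjPoint R ι) : Prop :=
  Quotient.lift₂ (s₁ := unitSetoid R ι) (s₂ := unitSetoid R ι)
    (fun a b => IsUnit (form S a.1 b.1)) (by
      rintro a b a' b' ⟨u, hu⟩ ⟨v, hv⟩
      simp only [hu, hv, form_smul_smul, eq_iff_iff]
      rw [← Units.val_mul, Units.isUnit_units_mul]) x y

/-- The graph on the isotropic points of a symmetric matrix `S`, with `[a]` and `[b]` adjacent
when `a S bᵗ` is a unit. -/
def isotropicGraph [Nontrivial R] (S : Matrix ι ι R) (hS : S.IsSymm) :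
    SimpleGraph {x : ProjPoint R ι // x.IsIsotropic S} where
  Adj x y := ProjPoint.UnitPairing S x.1 y.1
  symm := ⟨by
    rintro ⟨x, hx⟩ ⟨y, hy⟩ h
    induction x using Quotient.inductionOn
    induction y using Quotient.inductionOn
    change IsUnit (form S _ _) at h
    change IsUnit (form S _ _)
    rwa [form_comm hS]⟩
  loopless := ⟨by
    rintro ⟨x, hx⟩ h
    induction x using Quotient.inductionOn
    change form S _ _ = 0 at hx
    change IsUnit (form S _ _) at h
    rw [hx] at h
    exact not_isUnit_zero h⟩

end Graph

/-- The possible shapes of the block `Δ` of size `δ`: empty for `δ = 0`; `(1)` or `(z)` for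
`δ = 1`; `diag(1, -z)` for `δ = 2`. -/
inductive DeltaType : ℕ → Type
  | empty : DeltaType 0
  | one : DeltaType 1
  | nonsquare : DeltaType 1
  | two : DeltaType 2

section Orthogonal

variable {R : Type*} [CommRing R]

/-- The diagonal of the block `Δ`. -/
def DeltaType.diag (z : Rˣ) : {δ : ℕ} → DeltaType δ → Fin δ → R
  | _, .empty => ![]
  | _, .one => ![1]
  | _, .nonsquare => ![(z : R)]
  | _, .two => ![1, -(z : R)]

/-- The block matrix with rows `(0, I, 0)`, `(I, 0, 0)`, `(0, 0, Δ)`. -/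
def formMatrix (ν : ℕ) {δ : ℕ} (z : Rˣ) (D : DeltaType δ) :
    Matrix ((Fin ν ⊕ Fin ν) ⊕ Fin δ) ((Fin ν ⊕ Fin ν) ⊕ Fin δ) R :=
  Matrix.fromBlocks (Matrix.fromBlocks 0 1 1 0) 0 0 (Matrix.diagonal (D.diag z))

theorem formMatrix_isSymm (ν : ℕ) {δ : ℕ} (z : Rˣ) (D : DeltaType δ) :
    (formMatrix ν z D).IsSymm := by
  simp [formMatrix, Matrix.IsSymm, Matrix.fromBlocks_transpose]

/-- The orthogonal graph of size `2 ν + δ` over `R`. -/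
def orthogonalGraph [Nontrivial R] (ν : ℕ) {δ : ℕ} (z : Rˣ) (D : DeltaType δ) :
    SimpleGraph {x : ProjPoint R ((Fin ν ⊕ Fin ν) ⊕ Fin δ) //
      x.IsIsotropic (formMatrix ν z D)} :=
  isotropicGraph (formMatrix ν z D) (formMatrix_isSymm ν z D)

end Orthogonal

/-- `G` is quasi-strongly regular of grade `d` with parameters `(n, k, l; c 0, …, c (d - 1))`. -/
structure IsQuasiStronglyRegular {V : Type*} (G : SimpleGraph V) (n k l : ℕ) {d : ℕ}
    (c : Fin d → ℕ) : Prop where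
  injective : Function.Injective c
  finite : Finite V
  connected : G.Connected
  card_eq : Nat.card V = n
  valency : ∀ v, (G.neighborSet v).ncard = k
  of_adj : ∀ v w, G.Adj v w → (G.commonNeighbors v w).ncard = l
  of_not_adj : ∀ v w, v ≠ w → ¬ G.Adj v w → ∃ i, (G.commonNeighbors v w).ncard = c i

end OrthGraph

/-!
The graph is studied over any finite local ring `R` in which `2` is invertible, for any symmetric
invertible Gram matrix `S`. An isotropic vector `a` with a unit coordinate lies in a hyperbolic
pair `a`, `f` (`exists_isHyperbolicPair`), and the space splits as the sum of the hyperbolic plane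
of `a`, `f` and its orthogonal complement `W`. The neighbours of `[a]` are then the points
`[f + w - (w, w) / 2 • a]` with `w` in `W`, each obtained once (`neighborSet_eq_range`), so that
the valency is `|W|`, and common neighbours with a second vertex `[b]` are counted by the vectors
`w` for which a certain expression is a unit.

* If `[b]` is not adjacent to `[a]`, then up to a nonunit this expression is `(f, b) + (b, w)`,
  affine in `w`. Either the linear part vanishes modulo the maximal ideal, which means that `[a]`
  and `[b]` coincide there, and all of `W` is counted; or the linear part is surjective, and the
  proportion counted is that of the units in `R`.
* If `[b]` is adjacent to `[a]`, one may take `f = b`, and the expression is a unit multiple of the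
  norm `(w, w)`. The number of unit norms behaves predictably when a hyperbolic plane is added
  (`natCard_isUnit_hyperbolic`). This gives the number for the standard form by induction on `ν`,
  and then for every `W` by cancelling one plane, without appeal to Witt's theorem.

The number of vertices results from counting the paths of length two that start at a given vertex
(`exists_card_of_paths`); the vertices equal to `[a]` modulo the maximal ideal are counted by the
vectors of `W` that vanish there (`natCard_isClose`).

A Galois ring is such a local ring. The orders of `R` and of its maximal ideal come from the chain
of ideals `p ^ i R`, each step of which has the order of the annihilator of `p`. The binary form
`x² - z y²` is anisotropic over the residue field because the elements congruent to `1` modulo the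
maximal ideal are squares (`isSquare_of_not_isUnit_sub_one`).
-/

namespace OrthGraph

/-! ### Galois rings -/

theorem natCard_eq_range_mul_ker {A B : Type*} [AddCommGroup A] [AddCommGroup B] (f : A →+ B) :
    Nat.card A = Nat.card f.range * Nat.card f.ker := by
  rw [AddSubgroup.card_eq_card_quotient_mul_card_addSubgroup f.ker,
    Nat.card_congr (QuotientAddGroup.quotientKerEquivRange f).toEquiv]

namespace IsGaloisRing

variable {p s m : ℕ} {R : Type*} [CommRing R]

theorem isUnit_iff (hR : IsGaloisRing p s m R) {x : R} : IsUnit x ↔ ¬ (p : R) ∣ x := by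
  have := hR.finite
  have h := Set.ext_iff.mp hR.zeroDivisors_eq x
  rw [Set.mem_compl_iff, SetLike.mem_coe, SetLike.mem_coe, Ideal.mem_span_singleton] at h
  rw [isUnit_iff_mem_nonZeroDivisors_of_finite, ← h, not_not]

theorem isLocalRing [Nontrivial R] (hR : IsGaloisRing p s m R) : IsLocalRing R :=
  .of_nonunits_add fun {a b} ha hb => by
    rw [mem_nonunits_iff, hR.isUnit_iff, not_not] at ha hb ⊢
    exact dvd_add ha hb

theorem isUnit_two (hR : IsGaloisRing p s m R) (hp : Odd p) : IsUnit (2 : R) := by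
  rw [hR.isUnit_iff]
  rintro ⟨c, hc⟩
  obtain ⟨k, rfl⟩ := hp
  have h1 : ((2 * k + 1 : ℕ) : R) ∣ 1 := ⟨1 - c * k, by push_cast at hc ⊢; linear_combination -k * hc⟩
  exact hR.isUnit_iff.mp (isUnit_of_dvd_one h1) dvd_rfl

theorem pow_ne_zero (hR : IsGaloisRing p s m R) (hp : 1 < p) {i : ℕ} (hi : i < s) :
    (p : R) ^ i ≠ 0 := by
  have := hR.charP
  rw [← Nat.cast_pow, Ne, CharP.cast_eq_zero_iff R (p ^ s), Nat.pow_dvd_pow_iff_le_right hp]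
  lia

theorem pow_eq_zero (hR : IsGaloisRing p s m R) : (p : R) ^ s = 0 := by
  have := hR.charP
  rw [← Nat.cast_pow, CharP.cast_eq_zero]

/-- An element killed by `p` is divisible by every nonzero power of `p`, since a quotient by a
lower power of `p` cannot be a unit. -/
theorem pow_dvd_of_mul_eq_zero (hR : IsGaloisRing p s m R) (hp : 1 < p) {x : R}
    (hx : (p : R) * x = 0) {i : ℕ} (hi : i < s) : (p : R) ^ i ∣ x := by
  induction i with
  | zero => simp
  | succ i ih =>
    obtain ⟨y, rfl⟩ := ih (by lia)
    rw [pow_succ]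
    refine mul_dvd_mul_left _ ?_
    by_contra hy
    have := (hR.isUnit_iff.mpr hy).mul_left_eq_zero.mp
      (show (p : R) ^ (i + 1) * y = 0 by rw [← hx]; ring)
    exact hR.pow_ne_zero hp hi this

/-- The annihilator of `p`, as the kernel of multiplication by `p`. -/
def annP (p : ℕ) (R : Type*) [CommRing R] : AddSubgroup R := (AddMonoidHom.mulLeft (p : R)).ker

/-- The ideal `p ^ i R`, as the image of multiplication by `p ^ i`. -/
def powP (p : ℕ) (R : Type*) [CommRing R] (i : ℕ) : AddSubgroup R :=
  (AddMonoidHom.mulLeft ((p : R) ^ i)).range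

theorem mem_powP {i : ℕ} {x : R} : x ∈ powP p R i ↔ (p : R) ^ i ∣ x := by
  simp [powP, AddMonoidHom.mem_range, dvd_iff_exists_eq_mul_right, eq_comm]

theorem card_powP (hR : IsGaloisRing p s m R) (hp : 1 < p) {i : ℕ} (hi : i < s) :
    Nat.card (powP p R i) = Nat.card (powP p R (i + 1)) * Nat.card (annP p R) := by
  let f : powP p R i →+ R := (AddMonoidHom.mulLeft (p : R)).comp (powP p R i).subtype
  rw [natCard_eq_range_mul_ker f]
  congr 1
  · congr 1
    have : f.range = powP p R (i + 1) := by
      ext x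
      rw [mem_powP]
      constructor
      · rintro ⟨⟨y, hy⟩, rfl⟩
        rw [mem_powP] at hy
        rw [pow_succ']
        exact mul_dvd_mul_left _ hy
      · rintro ⟨y, rfl⟩
        exact ⟨⟨(p : R) ^ i * y, mem_powP.mpr ⟨y, rfl⟩⟩, by simp [f]; ring⟩
    rw [this]
  · refine Nat.card_congr ⟨fun x => ⟨x.1.1, x.2⟩, fun x => ⟨⟨x.1, ?_⟩, x.2⟩, fun _ => rfl,
      fun _ => rfl⟩
    exact mem_powP.mpr (hR.pow_dvd_of_mul_eq_zero hp x.2 hi)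

theorem card_powP_eq (hR : IsGaloisRing p s m R) (hp : 1 < p) (j : ℕ) (hj : j ≤ s) :
    Nat.card (powP p R (s - j)) = Nat.card (annP p R) ^ j := by
  induction j with
  | zero =>
    have : powP p R s = ⊥ := by
      ext x
      rw [mem_powP, hR.pow_eq_zero, zero_dvd_iff, AddSubgroup.mem_bot]
    simp [this]
  | succ j ih =>
    rw [hR.card_powP hp (by lia), show s - (j + 1) + 1 = s - j by lia, ih (by lia), pow_succ]

theorem card_annP (hR : IsGaloisRing p s m R) (hp : 1 < p) (hs : 1 ≤ s) :
    Nat.card (annP p R) = p ^ m := by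
  have h := hR.card_powP_eq hp s le_rfl
  have h0 : powP p R (s - s) = ⊤ := by
    ext x
    simp [mem_powP]
  rw [h0, AddSubgroup.card_top, hR.card_eq, mul_comm, pow_mul] at h
  exact (Nat.pow_left_injective (by lia) h).symm

theorem card_nonunits (hR : IsGaloisRing p s m R) (hp : 1 < p) (hs : 1 ≤ s) :
    Nat.card {x : R // ¬ IsUnit x} = (p ^ m) ^ (s - 1) := by
  rw [← hR.card_annP hp hs, ← hR.card_powP_eq hp (s - 1) (by lia)]
  refine Nat.card_congr (Equiv.subtypeEquivRight fun x => ?_)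
  rw [hR.isUnit_iff, not_not, show s - (s - 1) = 1 by lia, mem_powP, pow_one]

end IsGaloisRing

/-! ### Counting unit values over a finite local ring -/

section Counting

variable {R : Type*} [CommRing R]

theorem natCard_isUnit_add (R : Type*) [CommRing R] [Finite R] :
    Nat.card {x : R // IsUnit x} + Nat.card {x : R // ¬ IsUnit x} = Nat.card R := by
  classical
  have := Fintype.ofFinite R
  simp only [Nat.card_eq_fintype_card]
  rw [Fintype.card_subtype_compl, Nat.add_sub_cancel' (Fintype.card_subtype_le _)]

theorem sum_ite_natCard {X : Type*} [Fintype X] (P : X → Prop) [DecidablePred P] (a b : ℕ) :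
    ∑ x, (if P x then a else b) = Nat.card {x // P x} * a + Nat.card {x // ¬ P x} * b := by
  simp [Finset.sum_ite, Nat.card_eq_fintype_card, Fintype.card_subtype]

theorem natCard_isUnit_affine {x : R} (hx : IsUnit x) (c : R) :
    Nat.card {y : R // IsUnit (x * y + c)} = Nat.card {y : R // IsUnit y} :=
  Nat.card_congr
    ((hx.unit.mulLeft.trans (Equiv.addRight c)).subtypeEquiv fun y => by simp)

theorem isUnit_add_left_iff [IsLocalRing R] {a b : R} (ha : ¬ IsUnit a) :
    IsUnit (a + b) ↔ IsUnit b := by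
  constructor
  · intro h
    by_contra hb
    exact IsLocalRing.nonunits_add ha hb h
  · intro h
    by_contra hab
    refine IsLocalRing.nonunits_add (a := -a) (b := a + b) (by simpa using ha) hab ?_
    simpa using h

theorem not_isUnit_add [IsLocalRing R] {a b : R} (ha : ¬ IsUnit a) (hb : ¬ IsUnit b) :
    ¬ IsUnit (a + b) :=
  IsLocalRing.nonunits_add ha hb

theorem not_isUnit_mul {a b : R} (ha : ¬ IsUnit a) : ¬ IsUnit (a * b) :=
  fun h => ha (isUnit_of_mul_isUnit_left h)

/-- A hyperbolic plane added to a function `Q`: the number of unit values of `2 x y + Q w` in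
terms of the number of unit values of `Q`. -/
theorem natCard_isUnit_hyperbolic [Finite R] [IsLocalRing R] (h2 : IsUnit (2 : R))
    {W : Type*} [Finite W] (Q : W → R) :
    Nat.card {v : R × R × W // IsUnit (2 * (v.1 * v.2.1) + Q v.2.2)} =
      Nat.card {x : R // IsUnit x} ^ 2 * Nat.card W +
      Nat.card {x : R // ¬ IsUnit x} * Nat.card R * Nat.card {w // IsUnit (Q w)} := by
  classical
  have := Fintype.ofFinite R
  have := Fintype.ofFinite W
  let e : {v : R × R × W // IsUnit (2 * (v.1 * v.2.1) + Q v.2.2)} ≃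
      Σ w : W, Σ x : R, {y : R // IsUnit (2 * x * y + Q w)} :=
    { toFun := fun v => ⟨v.1.2.2, v.1.1, v.1.2.1, by rw [mul_assoc]; exact v.2⟩
      invFun := fun t => ⟨(t.2.1, t.2.2.1, t.1), by rw [← mul_assoc]; exact t.2.2.2⟩
      left_inv := fun _ => rfl
      right_inv := fun _ => rfl }
  have key (w : W) (x : R) : Nat.card {y : R // IsUnit (2 * x * y + Q w)} =
      if IsUnit x then Nat.card {x : R // IsUnit x} else
        if IsUnit (Q w) then Nat.card R else 0 := by
    split_ifs with hx hw
    · exact natCard_isUnit_affine (h2.mul hx) _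
    · refine Nat.card_congr (Equiv.subtypeUnivEquiv fun y => ?_)
      rwa [isUnit_add_left_iff]
      rw [mul_comm 2 x, mul_assoc]
      exact not_isUnit_mul hx
    · have : IsEmpty {y : R // IsUnit (2 * x * y + Q w)} := ⟨fun y => by
        have h := y.2
        rw [isUnit_add_left_iff] at h
        · exact hw h
        · rw [mul_assoc, mul_left_comm]
          exact not_isUnit_mul hx⟩
      exact Nat.card_of_isEmpty
  rw [Nat.card_congr e, Nat.card_sigma]
  simp only [Nat.card_sigma, key, sum_ite_natCard, Finset.sum_add_distrib, Finset.sum_const,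
    ← Finset.mul_sum, Finset.card_univ, ← Nat.card_eq_fintype_card, smul_eq_mul]
  ring

/-- A surjective linear form takes each value equally often, so the proportion of unit values of
one of its translates is that of the units in `R`. -/
theorem natCard_isUnit_linear [Finite R] {W : Type*} [AddCommGroup W] [Module R W] [Finite W]
    (l : W →ₗ[R] R) {w₀ : W} (hw₀ : l w₀ = 1) (c : R) :
    Nat.card {w // IsUnit (c + l w)} * Nat.card R =
      Nat.card W * Nat.card {x : R // IsUnit x} := by
  let e : W ≃ LinearMap.ker l × R :=
    { toFun := fun w => (⟨w - l w • w₀, by simp [hw₀]⟩, l w)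
      invFun := fun t => t.1.1 + t.2 • w₀
      left_inv := fun w => by simp
      right_inv := fun t => by
        have ht : l t.1.1 = 0 := t.1.2
        ext <;> simp [hw₀, ht] }
  let e' : {w // IsUnit (c + l w)} ≃ LinearMap.ker l × {x : R // IsUnit (c + x)} :=
    { toFun := fun w => ((e w.1).1, ⟨l w.1, w.2⟩)
      invFun := fun t => ⟨e.symm (t.1, t.2.1), by
        have : l (e.symm (t.1, t.2.1)) = t.2.1 := congrArg Prod.snd (e.apply_symm_apply (t.1, t.2.1))
        rw [this]
        exact t.2.2⟩
      left_inv := fun w => Subtype.ext (e.symm_apply_apply w.1)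
      right_inv := fun t => by
        have h := e.apply_symm_apply (t.1, t.2.1)
        ext
        · exact congrArg (fun z => (z.1 : W)) h
        · exact congrArg Prod.snd h }
  have h1 : Nat.card {x : R // IsUnit (c + x)} = Nat.card {x : R // IsUnit x} := by
    simpa [add_comm] using natCard_isUnit_affine (isUnit_one (M := R)) c
  rw [Nat.card_congr e', Nat.card_congr e, Nat.card_prod, Nat.card_prod, h1]
  ring

/-- In a finite local ring in which `2` is invertible, every element congruent to `1` modulo the
maximal ideal is a square: squaring is injective on these elements, because `x + y` is then
congruent to `2` and so cannot annihilate `x - y` unless `x = y`. -/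
theorem isSquare_of_not_isUnit_sub_one [Finite R] [IsLocalRing R] (h2 : IsUnit (2 : R)) {x : R}
    (hx : ¬ IsUnit (x - 1)) : IsSquare x := by
  let f : {x : R // ¬ IsUnit (x - 1)} → {x : R // ¬ IsUnit (x - 1)} := fun y =>
    ⟨y.1 * y.1, by
      rw [show y.1 * y.1 - 1 = (y.1 - 1) * (y.1 + 1) by ring]
      exact not_isUnit_mul y.2⟩
  have hf : Function.Injective f := by
    rintro ⟨a, ha⟩ ⟨b, hb⟩ hab
    have hab : a * a = b * b := congrArg Subtype.val hab
    have hu : IsUnit (a + b) := by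
      rw [show a + b = ((a - 1) + (b - 1)) + 2 by ring]
      rwa [isUnit_add_left_iff (not_isUnit_add ha hb)]
    have h0 : (a - b) * (a + b) = 0 := by linear_combination hab
    exact Subtype.ext (sub_eq_zero.mp (hu.mul_left_eq_zero.mp h0))
  obtain ⟨y, hy⟩ := Finite.surjective_of_injective hf ⟨x, hx⟩
  exact ⟨y.1, (congrArg Subtype.val hy).symm⟩

/-- For a nonsquare unit `z`, the form `x² - z y²` stays anisotropic over the residue field. -/
theorem isUnit_sq_sub_nonsquare_iff [Finite R] [IsLocalRing R] (h2 : IsUnit (2 : R)) {z : R}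
    (hz : IsUnit z) (hz' : ¬ IsSquare z) (x y : R) :
    IsUnit (x * x - z * (y * y)) ↔ IsUnit x ∨ IsUnit y := by
  constructor
  · intro h
    by_contra! hxy
    rw [show x * x - z * (y * y) = x * x + y * (-(z * y)) by ring] at h
    exact not_isUnit_add (not_isUnit_mul hxy.1) (not_isUnit_mul hxy.2) h
  · intro hxy
    by_contra h
    have hy : IsUnit y := by
      by_contra hy
      have hx := hxy.resolve_right hy
      rw [show x * x - z * (y * y) = y * (-(z * y)) + x * x by ring,
        isUnit_add_left_iff (not_isUnit_mul hy)] at h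
      exact h (hx.mul hx)
    have hx : IsUnit x := by
      by_contra hx
      rw [show x * x - z * (y * y) = x * x + -(z * (y * y)) by ring,
        isUnit_add_left_iff (not_isUnit_mul hx), IsUnit.neg_iff] at h
      exact h (hz.mul (hy.mul hy))
    obtain ⟨x', hx'⟩ := hx.exists_right_inv
    -- `z (y / x)²` is congruent to `1`, hence a square
    have hsq : IsSquare (z * (y * x') ^ 2) := by
      refine isSquare_of_not_isUnit_sub_one h2 ?_
      rw [show z * (y * x') ^ 2 - 1 = (x * x - z * (y * y)) * -(x' * x') by
        linear_combination (x * x' + 1) * hx']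
      exact not_isUnit_mul h
    obtain ⟨t, ht⟩ := hsq
    obtain ⟨y', hy'⟩ := hy.exists_right_inv
    refine hz' ⟨t * (x * y'), ?_⟩
    linear_combination (x * y') ^ 2 * ht - z * (x * x' * (y * y') + 1) * (x * x' * hy' + hx')

end Counting

/-! ### Hyperbolic pairs and their orthogonal complements -/

section Form

variable {R : Type*} [CommRing R] {ι : Type*} [Fintype ι] {S : Matrix ι ι R}

theorem form_add_left (a b c : ι → R) : form S (a + b) c = form S a c + form S b c := by
  simp [form, add_dotProduct]

theorem form_add_right (a b c : ι → R) : form S a (b + c) = form S a b + form S a c := by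
  simp [form, Matrix.mulVec_add, dotProduct_add]

theorem form_smul_left (r : R) (a b : ι → R) : form S (r • a) b = r * form S a b := by
  simp [form, smul_dotProduct]

theorem form_smul_right (r : R) (a b : ι → R) : form S a (r • b) = r * form S a b := by
  simp [form, Matrix.mulVec_smul, dotProduct_smul]

theorem form_sub_left (a b c : ι → R) : form S (a - b) c = form S a c - form S b c := by
  simp [form, sub_dotProduct]

theorem form_sub_right (a b c : ι → R) : form S a (b - c) = form S a b - form S a c := by
  simp [form, Matrix.mulVec_sub, dotProduct_sub]

theorem form_zero_right (a : ι → R) : form S a 0 = 0 := by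
  simp [form]

/-- Two isotropic vectors pairing to `1`, i.e. a basis of a hyperbolic plane. -/
structure IsHyperbolicPair (S : Matrix ι ι R) (a f : ι → R) : Prop where
  left : form S a a = 0
  right : form S f f = 0
  pair : form S a f = 1

/-- The vectors orthogonal to both `a` and `f`. -/
def perp (S : Matrix ι ι R) (a f : ι → R) : Submodule R (ι → R) where
  carrier := {w | form S a w = 0 ∧ form S f w = 0}
  zero_mem' := by simp [form_zero_right]
  add_mem' := by
    rintro x y ⟨h1, h2⟩ ⟨h3, h4⟩
    simp [form_add_right, h1, h2, h3, h4]
  smul_mem' := by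
    rintro r x ⟨h1, h2⟩
    simp [form_smul_right, h1, h2]

theorem IsHyperbolicPair.symm {a f : ι → R} (h : IsHyperbolicPair S a f) (hS : S.IsSymm) :
    IsHyperbolicPair S f a :=
  ⟨h.right, h.left, by rw [form_comm hS, h.pair]⟩

theorem perp_comm (a f : ι → R) : perp S a f = perp S f a := by
  ext w
  exact and_comm

section Perp

variable {a f : ι → R}

theorem form_left_perp (w : perp S a f) : form S a w = 0 := w.2.1

theorem form_right_perp (w : perp S a f) : form S f w = 0 := w.2.2

theorem form_perp_left (hS : S.IsSymm) (w : perp S a f) : form S w a = 0 := by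
  rw [form_comm hS, form_left_perp]

theorem form_perp_right (hS : S.IsSymm) (w : perp S a f) : form S w f = 0 := by
  rw [form_comm hS, form_right_perp]

/-- The splitting of the whole space into the hyperbolic plane spanned by `a` and `f` and its
orthogonal complement. -/
def splitEquiv (hS : S.IsSymm) (h : IsHyperbolicPair S a f) :
    (ι → R) ≃ R × R × perp S a f where
  toFun v := (form S f v, form S a v, ⟨v - form S f v • a - form S a v • f, by
    have h' := h.symm hS
    constructor <;>
    simp [form_sub_right, form_smul_right, h.left, h.right, h.pair, h'.pair]⟩)
  invFun t := t.1 • a + t.2.1 • f + t.2.2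
  left_inv v := by simp
  right_inv t := by
    have h' := h.symm hS
    have e1 := form_left_perp t.2.2
    have e2 := form_right_perp t.2.2
    ext <;> simp [form_add_right, form_smul_right, h.left, h.right, h.pair, h'.pair, e1, e2]
    ring

theorem splitEquiv_symm_apply (hS : S.IsSymm) (h : IsHyperbolicPair S a f)
    (t : R × R × perp S a f) :
    (splitEquiv hS h).symm t = t.1 • a + t.2.1 • f + t.2.2 := rfl

theorem form_split (hS : S.IsSymm) (h : IsHyperbolicPair S a f) (x y x' y' : R)
    (w w' : perp S a f) :
    form S (x • a + y • f + w) (x' • a + y' • f + w') = x * y' + y * x' + form S w w' := by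
  have h' := h.symm hS
  simp only [form_add_right, form_add_left, form_smul_left, form_smul_right, h.left, h.right,
    h.pair, h'.pair, form_left_perp, form_right_perp, form_perp_left hS, form_perp_right hS]
  ring

/-- The order of the complement, written without division or truncated subtraction. -/
theorem natCard_perp (hS : S.IsSymm) (h : IsHyperbolicPair S a f) :
    Nat.card R ^ 2 * Nat.card (perp S a f) = Nat.card R ^ Fintype.card ι := by
  have e := Nat.card_congr (splitEquiv hS h)
  rw [Nat.card_prod, Nat.card_prod] at e
  rw [pow_two, mul_assoc, ← e, Nat.card_fun, Nat.card_eq_fintype_card (α := ι)]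

theorem natCard_isUnit_form (hS : S.IsSymm) [Finite R] [IsLocalRing R] (h2 : IsUnit (2 : R))
    (h : IsHyperbolicPair S a f) :
    Nat.card {v : ι → R // IsUnit (form S v v)} =
      Nat.card {x : R // IsUnit x} ^ 2 * Nat.card (perp S a f) +
      Nat.card {x : R // ¬ IsUnit x} * Nat.card R *
        Nat.card {w : perp S a f // IsUnit (form S w w)} := by
  rw [← natCard_isUnit_hyperbolic h2 (fun w : perp S a f => form S w w)]
  refine Nat.card_congr ((splitEquiv hS h).subtypeEquiv fun v => ?_)
  obtain ⟨t, rfl⟩ := (splitEquiv hS h).symm.surjective v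
  rw [Equiv.apply_symm_apply, splitEquiv_symm_apply, form_split hS h]
  ring_nf

theorem exists_isUnit_of_form [IsLocalRing R] {a b : ι → R} (h : IsUnit (form S a b)) :
    ∃ i, IsUnit (a i) := by
  by_contra! ha
  have : form S a b ∈ IsLocalRing.maximalIdeal R :=
    Ideal.sum_mem _ fun i _ => Ideal.mul_mem_right _ _ (ha i)
  exact this h

variable [DecidableEq ι] {S' : Matrix ι ι R}

theorem form_inverse_single (hS' : S * S' = 1) (a : ι → R) (i : ι) :
    form S a (S'.mulVec (Pi.single i 1)) = a i := by
  rw [form, Matrix.mulVec_mulVec, hS', Matrix.one_mulVec, dotProduct_single_one]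

/-- For an invertible Gram matrix, a vector has a unit coordinate exactly when it pairs to a unit
with some vector. -/
theorem exists_isUnit_iff_exists_form [IsLocalRing R] (hS' : S * S' = 1) {a : ι → R} :
    (∃ i, IsUnit (a i)) ↔ ∃ b, IsUnit (form S a b) :=
  ⟨fun ⟨i, hi⟩ => ⟨_, (form_inverse_single hS' a i).symm ▸ hi⟩, fun ⟨_, hb⟩ =>
    exists_isUnit_of_form hb⟩

/-- An isotropic vector with a unit coordinate belongs to a hyperbolic pair. -/
theorem exists_isHyperbolicPair (hS : S.IsSymm) (h2 : IsUnit (2 : R)) (hS' : S * S' = 1)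
    {a : ι → R} (ha : ∃ i, IsUnit (a i)) (h0 : form S a a = 0) :
    ∃ f, IsHyperbolicPair S a f := by
  obtain ⟨i, hi⟩ := ha
  obtain ⟨c, hc⟩ := hi.exists_right_inv
  obtain ⟨d, hd⟩ := h2.exists_right_inv
  set v : ι → R := c • S'.mulVec (Pi.single i 1) with hv
  have hav : form S a v = 1 := by
    rw [hv, form_smul_right, form_inverse_single hS', mul_comm, hc]
  have hva : form S v a = 1 := by rw [form_comm hS, hav]
  refine ⟨v - (d * form S v v) • a, h0, ?_, ?_⟩
  · simp only [form_sub_left, form_sub_right, form_smul_left, form_smul_right, h0, hav, hva]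
    linear_combination -form S v v * hd
  · rw [form_sub_right, hav, form_smul_right, h0, mul_zero, sub_zero]

/-- The number of vectors of the orthogonal complement that vanish modulo the maximal ideal. As the
Gram matrix is invertible, these are the vectors pairing to nonunits with the whole complement. -/
theorem natCard_not_primitive_perp [Finite R] [IsLocalRing R] (hS : S.IsSymm) (hS' : S * S' = 1)
    (h : IsHyperbolicPair S a f) :
    Nat.card {x : R // ¬ IsUnit x} ^ 2 *
      Nat.card {u : perp S a f // ∀ w : perp S a f, ¬ IsUnit (form S u w)} =
      Nat.card {x : R // ¬ IsUnit x} ^ Fintype.card ι := by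
  have e1 : {v : ι → R // ∀ b, ¬ IsUnit (form S v b)} ≃ (ι → {x : R // ¬ IsUnit x}) :=
    (Equiv.subtypeEquivRight fun v => by
      rw [← not_exists, ← exists_isUnit_iff_exists_form hS', not_exists]).trans
      Equiv.subtypePiEquivPi
  have e2 : {v : ι → R // ∀ b, ¬ IsUnit (form S v b)} ≃
      {t : R × R × perp S a f // ¬ IsUnit t.1 ∧ ¬ IsUnit t.2.1 ∧
        ∀ w : perp S a f, ¬ IsUnit (form S t.2.2 w)} := by
    refine (splitEquiv hS h).subtypeEquiv fun v => ?_
    obtain ⟨t, rfl⟩ := (splitEquiv hS h).symm.surjective v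
    rw [Equiv.apply_symm_apply, (splitEquiv hS h).symm.surjective.forall]
    simp only [splitEquiv_symm_apply, form_split hS h]
    constructor
    · intro H
      exact ⟨by simpa [form_zero_right] using H (0, 1, 0),
        by simpa [form_zero_right] using H (1, 0, 0), fun w => by simpa using H (0, 0, w)⟩
    · rintro ⟨H1, H2, H3⟩ t'
      exact not_isUnit_add (not_isUnit_add (not_isUnit_mul H1) (not_isUnit_mul H2)) (H3 _)
  have e3 : {t : R × R × perp S a f // ¬ IsUnit t.1 ∧ ¬ IsUnit t.2.1 ∧
        ∀ w : perp S a f, ¬ IsUnit (form S t.2.2 w)} ≃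
      {x : R // ¬ IsUnit x} × {x : R // ¬ IsUnit x} ×
        {u : perp S a f // ∀ w : perp S a f, ¬ IsUnit (form S u w)} :=
    { toFun := fun t => (⟨t.1.1, t.2.1⟩, ⟨t.1.2.1, t.2.2.1⟩, ⟨t.1.2.2, t.2.2.2⟩)
      invFun := fun t => ⟨(t.1.1, t.2.1.1, t.2.2.1), t.1.2, t.2.1.2, t.2.2.2⟩
      left_inv := fun _ => rfl
      right_inv := fun _ => rfl }
  have e := Nat.card_congr (e1.symm.trans (e2.trans e3))
  rw [Nat.card_fun, Nat.card_prod, Nat.card_prod, Nat.card_eq_fintype_card (α := ι)] at e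
  rw [e]
  ring

end Perp

end Form

/-! ### Neighbourhoods in the isotropic graph -/

section Vertices

variable {R : Type*} [CommRing R] {ι : Type*} [Fintype ι] {S : Matrix ι ι R}

/-- The vertex represented by an isotropic vector with a unit coordinate. -/
def mkVertex (a : ι → R) (ha : ∃ i, IsUnit (a i)) (h0 : form S a a = 0) :
    {x : ProjPoint R ι // x.IsIsotropic S} :=
  ⟨Quotient.mk (unitSetoid R ι) ⟨a, ha⟩, h0⟩

theorem exists_eq_mkVertex (x : {x : ProjPoint R ι // x.IsIsotropic S}) :
    ∃ (a : ι → R) (ha : ∃ i, IsUnit (a i)) (h0 : form S a a = 0), x = mkVertex a ha h0 := by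
  obtain ⟨x, hx⟩ := x
  induction x using Quotient.inductionOn with
  | h a => exact ⟨a.1, a.2, hx, rfl⟩

theorem exists_hyperbolic_rep [DecidableEq ι] {S' : Matrix ι ι R} (hS : S.IsSymm)
    (h2 : IsUnit (2 : R)) (hS' : S * S' = 1)
    (x : {x : ProjPoint R ι // x.IsIsotropic S}) :
    ∃ (a f : ι → R) (ha : ∃ i, IsUnit (a i)) (ha0 : form S a a = 0),
      IsHyperbolicPair S a f ∧ x = mkVertex a ha ha0 := by
  obtain ⟨a, ha, ha0, rfl⟩ := exists_eq_mkVertex x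
  obtain ⟨f, hf⟩ := exists_isHyperbolicPair hS h2 hS' ha ha0
  exact ⟨a, f, ha, ha0, hf, rfl⟩

theorem mkVertex_eq_iff {a b : ι → R} {ha : ∃ i, IsUnit (a i)} {hb : ∃ i, IsUnit (b i)}
    {ha0 : form S a a = 0} {hb0 : form S b b = 0} :
    mkVertex a ha ha0 = mkVertex b hb hb0 ↔ ∃ u : Rˣ, a = (u : R) • b := by
  rw [Subtype.ext_iff]
  exact Quotient.eq (r := unitSetoid R ι)

instance [Finite R] : Finite {x : ProjPoint R ι // x.IsIsotropic S} :=
  have : Finite (UnitTuple R ι) := Subtype.finite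
  have : Finite (ProjPoint R ι) := Quotient.finite _
  Subtype.finite

theorem adj_mkVertex [Nontrivial R] (hS : S.IsSymm) {a b : ι → R} {ha : ∃ i, IsUnit (a i)}
    {hb : ∃ i, IsUnit (b i)} {ha0 : form S a a = 0} {hb0 : form S b b = 0} :
    (isotropicGraph S hS).Adj (mkVertex a ha ha0) (mkVertex b hb hb0) ↔ IsUnit (form S a b) :=
  Iff.rfl

/-- The vector `b` represents a vertex that coincides with the vertex of `a` modulo the maximal
ideal: it is not adjacent to that vertex and pairs to nonunits with the
orthogonal complement of the hyperbolic pair `a`, `f`. -/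
def IsClose (S : Matrix ι ι R) (a f b : ι → R) : Prop :=
  ¬ IsUnit (form S a b) ∧ ∀ w : perp S a f, ¬ IsUnit (form S b w)

theorem IsClose.isUnit_form [IsLocalRing R] [DecidableEq ι] {S' : Matrix ι ι R} {a f : ι → R}
    (hS : S.IsSymm) (hS' : S * S' = 1) (h : IsHyperbolicPair S a f)
    {b : ι → R} (hb : ∃ i, IsUnit (b i)) (hab : IsClose S a f b) : IsUnit (form S f b) := by
  obtain ⟨c, hc⟩ := (exists_isUnit_iff_exists_form hS').mp hb
  obtain ⟨t, rfl⟩ := (splitEquiv hS h).symm.surjective c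
  obtain ⟨h1, h2⟩ := hab
  rw [splitEquiv_symm_apply, form_add_right, form_add_right, form_smul_right, form_smul_right,
    add_assoc, form_comm hS b a, form_comm hS b f] at hc
  by_contra hf
  rw [mul_comm, mul_comm t.2.1] at hc
  exact not_isUnit_add (not_isUnit_mul h1) (not_isUnit_add (not_isUnit_mul hf) (h2 _)) hc

end Vertices

section Opposite

variable {R : Type*} [CommRing R] [Invertible (2 : R)] {ι : Type*} [Fintype ι]
  {S : Matrix ι ι R} {a f : ι → R}

/-- For a hyperbolic pair `a`, `f` and `w` orthogonal to both, the isotropic vector in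
`f + w + R a`. -/
def opp (a f : ι → R) (w : perp S a f) : ι → R :=
  f + w - (⅟(2 : R) * form S w w) • a

theorem form_opp (hS : S.IsSymm) (h : IsHyperbolicPair S a f) (x y : R) (u w : perp S a f) :
    form S (x • a + y • f + u) (opp a f w) =
      x + form S u w - y * (⅟(2 : R) * form S w w) := by
  have e : opp a f w = (-(⅟(2 : R) * form S w w)) • a + (1 : R) • f + w := by
    rw [opp, one_smul, neg_smul]
    abel
  rw [e, form_split hS h]
  ring

theorem form_left_opp (hS : S.IsSymm) (h : IsHyperbolicPair S a f) (w : perp S a f) :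
    form S a (opp a f w) = 1 := by
  simpa [form_zero_right, form_comm hS 0] using form_opp hS h 1 0 0 w

theorem form_right_opp (hS : S.IsSymm) (h : IsHyperbolicPair S a f) (w : perp S a f) :
    form S f (opp a f w) = -(⅟(2 : R) * form S w w) := by
  simpa [form_zero_right, form_comm hS 0] using form_opp hS h 0 1 0 w

theorem form_opp_self (hS : S.IsSymm) (h : IsHyperbolicPair S a f) (w : perp S a f) :
    form S (opp a f w) (opp a f w) = 0 := by
  have e : opp a f w = (-(⅟(2 : R) * form S w w)) • a + (1 : R) • f + w := by
    rw [opp, one_smul, neg_smul]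
    abel
  rw [e, form_split hS h]
  linear_combination -form S w w * mul_invOf_self (2 : R)

theorem opp_injective (hS : S.IsSymm) (h : IsHyperbolicPair S a f) :
    Function.Injective (opp (S := S) a f) := by
  intro w w' hw
  have h1 := form_right_opp hS h w
  rw [hw, form_right_opp hS h w'] at h1
  have h2 : ⅟(2 : R) * form S w w = ⅟(2 : R) * form S w' w' := by
    linear_combination h1
  rw [opp, opp, h2] at hw
  exact Subtype.ext (add_left_cancel (sub_left_injective hw))

/-- An isotropic vector pairing to `1` with `a` is one of the vectors `opp a f w`. -/
theorem exists_eq_opp (hS : S.IsSymm) (h : IsHyperbolicPair S a f) {c : ι → R}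
    (hc : form S c c = 0) (hac : form S a c = 1) : ∃ w : perp S a f, c = opp a f w := by
  obtain ⟨⟨x, y, w⟩, rfl⟩ := (splitEquiv hS h).symm.surjective c
  rw [splitEquiv_symm_apply] at hc hac ⊢
  have hy : y = 1 := by
    have e := form_split hS h 1 0 x y 0 w
    simp only [one_smul, zero_smul, add_zero, ZeroMemClass.coe_zero] at e
    rw [e, form_comm hS 0, form_zero_right] at hac
    linear_combination hac
  subst hy
  rw [form_split hS h] at hc
  have hx : x = -(⅟(2 : R) * form S w w) := by
    linear_combination ⅟(2 : R) * hc - x * mul_invOf_self (2 : R)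
  refine ⟨w, ?_⟩
  rw [opp, hx]
  simp only [one_smul, neg_smul]
  abel

variable [IsLocalRing R]

theorem exists_isUnit_opp (hS : S.IsSymm) (h : IsHyperbolicPair S a f) (w : perp S a f) :
    ∃ i, IsUnit (opp a f w i) := by
  refine exists_isUnit_of_form (S := S) (b := a) ?_
  rw [form_comm hS, form_left_opp hS h]
  exact isUnit_one

/-- The vertex represented by `opp a f w`. These are exactly the neighbours of the vertex of
`a`. -/
def oppVertex (hS : S.IsSymm) (h : IsHyperbolicPair S a f) (w : perp S a f) :
    {x : ProjPoint R ι // x.IsIsotropic S} :=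
  mkVertex (opp a f w) (exists_isUnit_opp hS h w) (form_opp_self hS h w)

theorem oppVertex_injective (hS : S.IsSymm) (h : IsHyperbolicPair S a f) :
    Function.Injective (oppVertex hS h) := by
  intro w w' hw
  obtain ⟨u, hu⟩ := mkVertex_eq_iff.mp hw
  have h1 := congrArg (form S a) hu
  rw [form_smul_right, form_left_opp hS h, form_left_opp hS h, mul_one] at h1
  rw [← h1, one_smul] at hu
  exact opp_injective hS h hu

variable {ha : ∃ i, IsUnit (a i)} {ha0 : form S a a = 0}

theorem neighborSet_eq_range (hS : S.IsSymm) (h : IsHyperbolicPair S a f) :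
    (isotropicGraph S hS).neighborSet (mkVertex a ha ha0) = Set.range (oppVertex hS h) := by
  ext x
  obtain ⟨c, hc, hc0, rfl⟩ := exists_eq_mkVertex x
  rw [SimpleGraph.mem_neighborSet, adj_mkVertex]
  constructor
  · rintro ⟨u, hu⟩
    obtain ⟨w, hw⟩ := exists_eq_opp (c := (↑u⁻¹ : R) • c) hS h
      (by rw [form_smul_smul, hc0, mul_zero]) (by rw [form_smul_right, ← hu, Units.inv_mul])
    exact ⟨w, mkVertex_eq_iff.mpr ⟨u⁻¹, hw.symm⟩⟩
  · rintro ⟨w, hw⟩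
    obtain ⟨u, hu⟩ := mkVertex_eq_iff.mp hw
    have h1 := congrArg (form S a) hu
    rw [form_left_opp hS h, form_smul_right] at h1
    exact .of_mul_eq_one_right _ h1.symm

theorem ncard_neighborSet (hS : S.IsSymm) (h : IsHyperbolicPair S a f) :
    ((isotropicGraph S hS).neighborSet (mkVertex a ha ha0)).ncard = Nat.card (perp S a f) := by
  rw [neighborSet_eq_range hS h, ← Set.image_univ,
    Set.ncard_image_of_injective _ (oppVertex_injective hS h), Set.ncard_univ]

theorem ncard_commonNeighbors (hS : S.IsSymm) (h : IsHyperbolicPair S a f) {b : ι → R}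
    {hb : ∃ i, IsUnit (b i)} {hb0 : form S b b = 0} :
    ((isotropicGraph S hS).commonNeighbors (mkVertex a ha ha0) (mkVertex b hb hb0)).ncard =
      Nat.card {w : perp S a f // IsUnit (form S b (opp a f w))} := by
  have : (isotropicGraph S hS).commonNeighbors (mkVertex a ha ha0) (mkVertex b hb hb0) =
      oppVertex hS h '' {w | IsUnit (form S b (opp a f w))} := by
    ext x
    rw [SimpleGraph.mem_commonNeighbors, ← SimpleGraph.mem_neighborSet,
      neighborSet_eq_range hS h]
    constructor
    · rintro ⟨⟨w, rfl⟩, hx⟩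
      exact ⟨w, hx, rfl⟩
    · rintro ⟨w, hw, rfl⟩
      exact ⟨⟨w, rfl⟩, hw⟩
  rw [this, Set.ncard_image_of_injective _ (oppVertex_injective hS h)]
  rfl

/-- Adjacent vertices may be represented by a hyperbolic pair, and their common neighbours then
correspond to the orthogonal vectors of unit norm. -/
theorem ncard_commonNeighbors_of_adj (hS : S.IsSymm)
    {x y : {x : ProjPoint R ι // x.IsIsotropic S}} (hxy : (isotropicGraph S hS).Adj x y) :
    ∃ a f : ι → R, IsHyperbolicPair S a f ∧
      ((isotropicGraph S hS).commonNeighbors x y).ncard =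
        Nat.card {w : perp S a f // IsUnit (form S w w)} := by
  obtain ⟨a, ha, ha0, rfl⟩ := exists_eq_mkVertex x
  obtain ⟨b, hb, hb0, rfl⟩ := exists_eq_mkVertex y
  obtain ⟨u, hu⟩ := adj_mkVertex hS |>.mp hxy
  have h : IsHyperbolicPair S a ((↑u⁻¹ : R) • b) :=
    ⟨ha0, by rw [form_smul_smul, hb0, mul_zero], by rw [form_smul_right, ← hu, Units.inv_mul]⟩
  refine ⟨a, _, h, ?_⟩
  rw [ncard_commonNeighbors hS h]
  refine Nat.card_congr (Equiv.subtypeEquivRight fun w => ?_)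
  have e := form_right_opp hS h w
  rw [form_smul_left] at e
  have hu' : IsUnit (↑u⁻¹ : R) := u⁻¹.isUnit
  have h2 : IsUnit (⅟(2 : R)) := isUnit_of_invertible _
  calc IsUnit (form S b (opp a _ w)) ↔ IsUnit (↑u⁻¹ * form S b (opp a _ w)) := by
        rw [IsUnit.mul_iff, and_iff_right hu']
    _ ↔ _ := by rw [e, IsUnit.neg_iff, IsUnit.mul_iff, and_iff_right h2]

theorem form_opp_of_not_isUnit (hS : S.IsSymm) {b : ι → R}
    (hab : ¬ IsUnit (form S a b)) (w : perp S a f) :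
    IsUnit (form S b (opp a f w)) ↔ IsUnit (form S f b + form S b w) := by
  rw [opp, form_sub_right, form_add_right, form_smul_right, form_comm hS b a, form_comm hS b f,
    sub_eq_neg_add, isUnit_add_left_iff]
  rw [IsUnit.neg_iff, mul_comm]
  exact not_isUnit_mul hab

theorem ncard_commonNeighbors_of_not_isClose [Finite R] (hS : S.IsSymm)
    (h : IsHyperbolicPair S a f) {b : ι → R}
    {hb : ∃ i, IsUnit (b i)} {hb0 : form S b b = 0} (hab : ¬ IsUnit (form S a b))
    (hab' : ¬ IsClose S a f b) :
    ((isotropicGraph S hS).commonNeighbors (mkVertex a ha ha0) (mkVertex b hb hb0)).ncard *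
      Nat.card R = Nat.card (perp S a f) * Nat.card {x : R // IsUnit x} := by
  rw [IsClose, not_and, not_forall] at hab'
  obtain ⟨w, hw⟩ := hab' hab
  obtain ⟨u, hu⟩ := not_not.mp hw
  let l : perp S a f →ₗ[R] R :=
    { toFun := fun w => form S b w
      map_add' := fun x y => form_add_right _ _ _
      map_smul' := fun r x => form_smul_right _ _ _ }
  have hl : l ((↑u⁻¹ : R) • w) = 1 := by
    rw [map_smul]
    change (↑u⁻¹ : R) * form S b w = 1
    rw [← hu, Units.inv_mul]
  rw [ncard_commonNeighbors hS h, ← natCard_isUnit_linear l hl (form S f b)]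
  congr 1
  exact Nat.card_congr (Equiv.subtypeEquivRight fun w => form_opp_of_not_isUnit hS hab w)

variable [DecidableEq ι] {S' : Matrix ι ι R}

theorem ncard_commonNeighbors_of_isClose (hS : S.IsSymm) (hS' : S * S' = 1)
    (h : IsHyperbolicPair S a f) {b : ι → R}
    {hb : ∃ i, IsUnit (b i)} {hb0 : form S b b = 0} (hab : IsClose S a f b) :
    ((isotropicGraph S hS).commonNeighbors (mkVertex a ha ha0) (mkVertex b hb hb0)).ncard =
      Nat.card (perp S a f) := by
  rw [ncard_commonNeighbors hS h]
  refine Nat.card_congr (Equiv.subtypeUnivEquiv fun w => ?_)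
  rw [form_opp_of_not_isUnit hS hab.1, add_comm, isUnit_add_left_iff (hab.2 w)]
  exact hab.isUnit_form hS hS' h hb

/-- The vertices close to that of `a` are the opposite vertices of `f` attached to the vectors
vanishing modulo the maximal ideal. -/
theorem natCard_isClose (hS : S.IsSymm) (hS' : S * S' = 1) (h : IsHyperbolicPair S a f) :
    {x : {x : ProjPoint R ι // x.IsIsotropic S} |
        ∃ b hb hb0, x = mkVertex b hb hb0 ∧ IsClose S a f b}.ncard =
      Nat.card {u : perp S a f // ∀ w : perp S a f, ¬ IsUnit (form S u w)} := by
  have h' := h.symm hS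
  have hf : ∃ i, IsUnit (f i) := exists_isUnit_of_form (S := S) (b := a) (by
    rw [h'.pair]; exact isUnit_one)
  have hopp (u : perp S f a) : IsClose S a f (opp f a u) ↔
      ∀ w : perp S f a, ¬ IsUnit (form S u w) := by
    have hw (w : perp S f a) : form S (opp f a u) w = form S u w := by
      rw [opp, form_sub_left, form_add_left, form_smul_left, form_left_perp, form_right_perp]
      ring
    rw [IsClose, form_right_opp hS h', IsUnit.neg_iff, perp_comm a f]
    simp only [hw]
    refine ⟨fun H => H.2, fun H => ⟨?_, H⟩⟩
    rw [mul_comm]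
    exact not_isUnit_mul (H u)
  have : {x : {x : ProjPoint R ι // x.IsIsotropic S} |
        ∃ b hb hb0, x = mkVertex b hb hb0 ∧ IsClose S a f b} =
      oppVertex hS h' '' {u | ∀ w : perp S f a, ¬ IsUnit (form S u w)} := by
    ext x
    constructor
    · rintro ⟨b, hb, hb0, rfl, hab⟩
      obtain ⟨u, hu⟩ := hab.isUnit_form hS hS' h hb
      have hadj : mkVertex b hb hb0 ∈ (isotropicGraph S hS).neighborSet
          (mkVertex f hf h.right) := ⟨u, hu⟩
      rw [neighborSet_eq_range hS h'] at hadj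
      obtain ⟨w, hw⟩ := hadj
      refine ⟨w, (hopp w).mp ?_, hw⟩
      obtain ⟨v, hv⟩ := mkVertex_eq_iff.mp hw
      rw [hv, IsClose]
      simp only [form_smul_left, form_smul_right, Units.isUnit_units_mul]
      exact hab
    · rintro ⟨u, hu, rfl⟩
      exact ⟨_, _, _, rfl, (hopp u).mpr hu⟩
  rw [this, Set.ncard_image_of_injective _ (oppVertex_injective hS h'), perp_comm a f]
  rfl

end Opposite

/-! ### Parameters of the isotropic graph -/

/-- Counting paths of length two from a vertex `x` in a regular graph. The vertices not adjacent
to `x` fall into a set `Z`, where every neighbour of `x` is a common neighbour, and `r` others. -/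
theorem exists_card_of_paths {V : Type*} [Finite V] (G : SimpleGraph V) {k l c : ℕ}
    (hk : ∀ v, (G.neighborSet v).ncard = k) (x : V)
    (hl : ∀ y, G.Adj x y → (G.commonNeighbors x y).ncard = l) (Z : Set V)
    (hZ : ∀ y ∈ Z, ¬ G.Adj x y ∧ (G.commonNeighbors x y).ncard = k)
    (hc : ∀ y ∉ Z, ¬ G.Adj x y → (G.commonNeighbors x y).ncard = c) :
    ∃ r, Nat.card V = k + Z.ncard + r ∧ k * k = k * l + Z.ncard * k + r * c := by
  classical
  have := Fintype.ofFinite V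
  have hZk : Nat.card {y // y ∈ Z} = Z.ncard := Nat.card_coe_set_eq Z
  have hNk (v : V) : Nat.card {y // G.Adj v y} = k := by
    rw [← hk v]
    exact Nat.card_coe_set_eq _
  refine ⟨Nat.card {y // ¬ G.Adj x y ∧ y ∉ Z}, ?_, ?_⟩
  · have h1 (y : V) : 1 = (if G.Adj x y then 1 else 0) + (if y ∈ Z then 1 else 0) +
        (if ¬ G.Adj x y ∧ y ∉ Z then 1 else 0) := by
      have := hZ y
      split_ifs <;> tauto
    have h2 : Nat.card V = ∑ _y : V, 1 := by simp
    rw [h2, Finset.sum_congr rfl fun y _ => h1 y, Finset.sum_add_distrib, Finset.sum_add_distrib,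
      sum_ite_natCard, sum_ite_natCard, sum_ite_natCard, hZk, hNk]
    ring
  -- a path `x`, `z`, `y` is counted by its end point and then by its middle point
  · let e : (Σ y, G.commonNeighbors x y) ≃ Σ z : G.neighborSet x, G.neighborSet z.1 :=
      { toFun := fun t => ⟨⟨t.2.1, t.2.2.1⟩, ⟨t.1, (t.2.2.2 : G.Adj _ _).symm⟩⟩
        invFun := fun t => ⟨t.2.1, ⟨t.1.1, t.1.2, (t.2.2 : G.Adj _ _).symm⟩⟩
        left_inv := fun _ => rfl
        right_inv := fun _ => rfl }
    have he := Nat.card_congr e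
    rw [Nat.card_sigma, Nat.card_sigma] at he
    simp only [Nat.card_coe_set_eq, hk, Finset.sum_const, Finset.card_univ, smul_eq_mul] at he
    rw [← Nat.card_eq_fintype_card, Nat.card_coe_set_eq, hk] at he
    have h1 (y : V) : (G.commonNeighbors x y).ncard = (if G.Adj x y then l else 0) +
        (if y ∈ Z then k else 0) + (if ¬ G.Adj x y ∧ y ∉ Z then c else 0) := by
      have h1 := hZ y
      have h2 := hl y
      have h3 := hc y
      split_ifs <;> simp_all
    rw [← he, Finset.sum_congr rfl fun y _ => h1 y, Finset.sum_add_distrib,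
      Finset.sum_add_distrib, sum_ite_natCard, sum_ite_natCard, sum_ite_natCard, hZk, hNk]
    ring

section Parameters

variable {R : Type*} [CommRing R] {ι : Type*} [Fintype ι] {S : Matrix ι ι R}

theorem natCard_perp_eq [Finite R] [Nontrivial R] (hS : S.IsSymm) {a f : ι → R}
    (h : IsHyperbolicPair S a f) {k : ℕ}
    (hk : Nat.card R ^ 2 * k = Nat.card R ^ Fintype.card ι) : Nat.card (perp S a f) = k :=
  Nat.eq_of_mul_eq_mul_left (pow_pos Nat.card_pos 2) ((natCard_perp hS h).trans hk.symm)

variable [Finite R] [IsLocalRing R]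

theorem ncard_commonNeighbors_of_not_isClose_eq (hS : S.IsSymm) (h2 : IsUnit (2 : R))
    {k c : ℕ} (hk : Nat.card R ^ 2 * k = Nat.card R ^ Fintype.card ι)
    (hc : c * Nat.card R = k * Nat.card {x : R // IsUnit x})
    {a f b : ι → R} {ha : ∃ i, IsUnit (a i)} {ha0 : form S a a = 0} {hb : ∃ i, IsUnit (b i)}
    {hb0 : form S b b = 0} (h : IsHyperbolicPair S a f) (hab : ¬ IsUnit (form S a b))
    (hab' : ¬ IsClose S a f b) :
    ((isotropicGraph S hS).commonNeighbors (mkVertex a ha ha0) (mkVertex b hb hb0)).ncard = c := by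
  let _ := h2.invertible
  refine Nat.eq_of_mul_eq_mul_right (Nat.card_pos (α := R)) ?_
  rw [ncard_commonNeighbors_of_not_isClose hS h hab hab', natCard_perp_eq hS h hk, hc]

/-- Since all the splittings of the space have complements of the same size, the number of unit
norms in a complement is determined by the number of unit norms in the whole space. -/
theorem ncard_commonNeighbors_of_adj_eq (hS : S.IsSymm) (h2 : IsUnit (2 : R)) {k l : ℕ}
    (hk : Nat.card R ^ 2 * k = Nat.card R ^ Fintype.card ι)
    (hl : Nat.card {v : ι → R // IsUnit (form S v v)} =
      Nat.card {x : R // IsUnit x} ^ 2 * k +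
        Nat.card {x : R // ¬ IsUnit x} * Nat.card R * l)
    {x y : {x : ProjPoint R ι // x.IsIsotropic S}} (hxy : (isotropicGraph S hS).Adj x y) :
    ((isotropicGraph S hS).commonNeighbors x y).ncard = l := by
  let _ := h2.invertible
  obtain ⟨a, f, h, he⟩ := ncard_commonNeighbors_of_adj hS hxy
  have : Nonempty {x : R // ¬ IsUnit x} := ⟨⟨0, not_isUnit_zero⟩⟩
  rw [natCard_isUnit_form hS h2 h, natCard_perp_eq hS h hk] at hl
  rw [he]
  exact Nat.eq_of_mul_eq_mul_left (Nat.mul_pos Nat.card_pos Nat.card_pos) (Nat.add_left_cancel hl)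

variable [DecidableEq ι] {S' : Matrix ι ι R}

theorem ncard_neighborSet_eq (hS : S.IsSymm) (h2 : IsUnit (2 : R)) (hS' : S * S' = 1) {k : ℕ}
    (hk : Nat.card R ^ 2 * k = Nat.card R ^ Fintype.card ι)
    (x : {x : ProjPoint R ι // x.IsIsotropic S}) :
    ((isotropicGraph S hS).neighborSet x).ncard = k := by
  obtain ⟨a, f, ha, ha0, h, rfl⟩ := exists_hyperbolic_rep hS h2 hS' x
  let _ := h2.invertible
  rw [ncard_neighborSet hS h, natCard_perp_eq hS h hk]

theorem ncard_commonNeighbors_of_isClose_eq (hS : S.IsSymm) (h2 : IsUnit (2 : R))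
    (hS' : S * S' = 1) {k : ℕ} (hk : Nat.card R ^ 2 * k = Nat.card R ^ Fintype.card ι)
    {a f b : ι → R} {ha : ∃ i, IsUnit (a i)} {ha0 : form S a a = 0} {hb : ∃ i, IsUnit (b i)}
    {hb0 : form S b b = 0} (h : IsHyperbolicPair S a f) (hab : IsClose S a f b) :
    ((isotropicGraph S hS).commonNeighbors (mkVertex a ha ha0) (mkVertex b hb hb0)).ncard = k := by
  let _ := h2.invertible
  rw [ncard_commonNeighbors_of_isClose hS hS' h hab, natCard_perp_eq hS h hk]

theorem ncard_commonNeighbors_of_not_adj (hS : S.IsSymm) (h2 : IsUnit (2 : R))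
    (hS' : S * S' = 1) {k c : ℕ} (hk : Nat.card R ^ 2 * k = Nat.card R ^ Fintype.card ι)
    (hc : c * Nat.card R = k * Nat.card {x : R // IsUnit x})
    {x y : {x : ProjPoint R ι // x.IsIsotropic S}} (hxy : ¬ (isotropicGraph S hS).Adj x y) :
    ((isotropicGraph S hS).commonNeighbors x y).ncard = c ∨
      ((isotropicGraph S hS).commonNeighbors x y).ncard = k := by
  obtain ⟨a, f, ha, ha0, h, rfl⟩ := exists_hyperbolic_rep hS h2 hS' x
  obtain ⟨b, hb, hb0, rfl⟩ := exists_eq_mkVertex y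
  by_cases hab : IsClose S a f b
  · exact .inr (ncard_commonNeighbors_of_isClose_eq hS h2 hS' hk h hab)
  · exact .inl (ncard_commonNeighbors_of_not_isClose_eq hS h2 hk hc h hxy hab)

/-- The number of vertices is `k + C + r`, where `k` vertices are adjacent to a given one, `C` are
close to it and `r` are neither; counting paths of length two determines `r`. -/
theorem exists_card_vertices (hS : S.IsSymm) (h2 : IsUnit (2 : R)) (hS' : S * S' = 1)
    {k l c C : ℕ} (hk : Nat.card R ^ 2 * k = Nat.card R ^ Fintype.card ι)
    (hl : Nat.card {v : ι → R // IsUnit (form S v v)} =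
      Nat.card {x : R // IsUnit x} ^ 2 * k +
        Nat.card {x : R // ¬ IsUnit x} * Nat.card R * l)
    (hc : c * Nat.card R = k * Nat.card {x : R // IsUnit x})
    (hC : Nat.card {x : R // ¬ IsUnit x} ^ 2 * C =
      Nat.card {x : R // ¬ IsUnit x} ^ Fintype.card ι)
    (x : {x : ProjPoint R ι // x.IsIsotropic S}) :
    ∃ r, Nat.card {x : ProjPoint R ι // x.IsIsotropic S} = k + C + r ∧
      k * k = k * l + C * k + r * c := by
  obtain ⟨a, f, ha, ha0, h, rfl⟩ := exists_hyperbolic_rep hS h2 hS' x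
  have : Nonempty {x : R // ¬ IsUnit x} := ⟨⟨0, not_isUnit_zero⟩⟩
  have hCeq : {x : {x : ProjPoint R ι // x.IsIsotropic S} |
      ∃ b hb hb0, x = mkVertex b hb hb0 ∧ IsClose S a f b}.ncard = C := by
    let _ := h2.invertible
    rw [natCard_isClose hS hS' h]
    exact Nat.eq_of_mul_eq_mul_left (pow_pos Nat.card_pos 2)
      ((natCard_not_primitive_perp hS hS' h).trans hC.symm)
  rw [← hCeq]
  refine exists_card_of_paths (isotropicGraph S hS) (ncard_neighborSet_eq hS h2 hS' hk)
    (mkVertex a ha ha0) (fun y => ncard_commonNeighbors_of_adj_eq hS h2 hk hl) _ ?_ ?_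
  · rintro y ⟨b, hb, hb0, rfl, hab⟩
    exact ⟨hab.1, ncard_commonNeighbors_of_isClose_eq hS h2 hS' hk h hab⟩
  · intro y hy hxy
    obtain ⟨b, hb, hb0, rfl⟩ := exists_eq_mkVertex y
    exact ncard_commonNeighbors_of_not_isClose_eq hS h2 hk hc h hxy
      fun hab => hy ⟨b, hb, hb0, rfl, hab⟩

end Parameters

/-! ### The standard form -/

section Standard

variable {R : Type*} [CommRing R]

theorem DeltaType.isUnit_diag (z : Rˣ) {δ : ℕ} (D : DeltaType δ) (i : Fin δ) :
    IsUnit (D.diag z i) := by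
  cases D <;> fin_cases i <;> simp [DeltaType.diag]

theorem exists_formMatrix_mul_eq_one (ν : ℕ) {δ : ℕ} (z : Rˣ) (D : DeltaType δ) :
    ∃ S', formMatrix ν z D * S' = 1 := by
  refine ⟨Matrix.fromBlocks (Matrix.fromBlocks 0 1 1 0) 0 0
    (Matrix.diagonal fun i => Ring.inverse (D.diag z i)), ?_⟩
  simp [formMatrix, Matrix.fromBlocks_multiply, Matrix.diagonal_mul_diagonal,
    Ring.mul_inverse_cancel _ (D.isUnit_diag z _)]

theorem form_formMatrix (ν : ℕ) {δ : ℕ} (z : Rˣ) (D : DeltaType δ)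
    (v : (Fin ν ⊕ Fin ν) ⊕ Fin δ → R) :
    form (formMatrix ν z D) v v =
      2 * (∑ i, v (.inl (.inl i)) * v (.inl (.inr i))) +
        ∑ j, D.diag z j * (v (.inr j) * v (.inr j)) := by
  simp only [form, formMatrix, Matrix.fromBlocks_mulVec, dotProduct, Fintype.sum_sum_type,
    Sum.elim_inl, Sum.elim_inr, Function.comp_def, Matrix.zero_mulVec, Matrix.one_mulVec,
    Matrix.mulVec_diagonal, zero_add, add_zero]
  rw [two_mul]
  congr 1
  · congr 1
    exact Finset.sum_congr rfl fun i _ => mul_comm _ _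
  · exact Finset.sum_congr rfl fun i _ => by ring

/-- The number of unit values of the orthogonal sum of `ν` hyperbolic planes and a function
`g`. -/
noncomputable def unitCount {X : Type*} (ν : ℕ) (g : X → R) : ℕ :=
  Nat.card {v : (Fin ν → R) × (Fin ν → R) × X //
    IsUnit (2 * (∑ i, v.1 i * v.2.1 i) + g v.2.2)}

theorem unitCount_zero {X : Type*} (g : X → R) : unitCount 0 g = Nat.card {t // IsUnit (g t)} :=
  Nat.card_congr
    { toFun := fun v => ⟨v.1.2.2, by simpa using v.2⟩
      invFun := fun t => ⟨(0, 0, t.1), by simpa using t.2⟩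
      left_inv := fun v => Subtype.ext (Prod.ext (Subsingleton.elim _ _)
        (Prod.ext (Subsingleton.elim _ _) rfl))
      right_inv := fun _ => rfl }

theorem unitCount_succ [Finite R] [IsLocalRing R] (h2 : IsUnit (2 : R)) {X : Type*} [Finite X]
    (ν : ℕ) (g : X → R) :
    unitCount (ν + 1) g =
      Nat.card {x : R // IsUnit x} ^ 2 * (Nat.card R ^ (2 * ν) * Nat.card X) +
        Nat.card {x : R // ¬ IsUnit x} * Nat.card R * unitCount ν g := by
  have e := natCard_isUnit_hyperbolic h2 (fun v : (Fin ν → R) × (Fin ν → R) × X =>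
    2 * (∑ i, v.1 i * v.2.1 i) + g v.2.2)
  have hW : Nat.card ((Fin ν → R) × (Fin ν → R) × X) = Nat.card R ^ (2 * ν) * Nat.card X := by
    rw [Nat.card_prod, Nat.card_prod, Nat.card_fun, Nat.card_fin]
    ring
  rw [hW] at e
  rw [unitCount, unitCount, ← e]
  refine Nat.card_congr
    { toFun := fun v => ⟨(v.1.1 0, v.1.2.1 0, Fin.tail v.1.1, Fin.tail v.1.2.1, v.1.2.2), ?_⟩
      invFun := fun t => ⟨(Fin.cons t.1.1 t.1.2.2.1, Fin.cons t.1.2.1 t.1.2.2.2.1,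
        t.1.2.2.2.2), ?_⟩
      left_inv := fun v => by simp
      right_inv := fun t => by simp }
  · have := v.2
    rw [Fin.sum_univ_succ, mul_add, add_assoc] at this
    exact this
  · have := t.2
    rw [Fin.sum_univ_succ, mul_add, add_assoc]
    simpa using this

theorem natCard_isUnit_formMatrix (ν : ℕ) {δ : ℕ} (z : Rˣ) (D : DeltaType δ) :
    Nat.card {v : (Fin ν ⊕ Fin ν) ⊕ Fin δ → R // IsUnit (form (formMatrix ν z D) v v)} =
      unitCount ν fun t : Fin δ → R => ∑ j, D.diag z j * (t j * t j) := by
  refine Nat.card_congr (((Equiv.sumArrowEquivProdArrow _ _ _).trans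
    (((Equiv.sumArrowEquivProdArrow _ _ _).prodCongr (Equiv.refl _)).trans
      (Equiv.prodAssoc _ _ _))).subtypeEquiv fun v => ?_)
  rw [form_formMatrix]
  rfl

end Standard

/-! ### Closed forms -/

section ClosedForms

variable {R : Type*} [CommRing R] [Finite R]

theorem cast_natCard_isUnit {q M : ℝ} (hT : (Nat.card R : ℝ) = q * M)
    (hM : (Nat.card {x : R // ¬ IsUnit x} : ℝ) = M) :
    (Nat.card {x : R // IsUnit x} : ℝ) = (q - 1) * M := by
  have := congrArg (Nat.cast : ℕ → ℝ) (natCard_isUnit_add R)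
  push_cast at this
  linear_combination this + hT - hM

/-- With `q` the order of the residue field, adding `ν` hyperbolic planes to `g` makes the
proportion of unit values `(1 - 1 / q) * (1 + t / q ^ ν)`, if it is `(1 - 1 / q) * (1 + t)`
for `g` itself. -/
theorem unitCount_closed [IsLocalRing R] (h2 : IsUnit (2 : R)) {X : Type*} [Finite X] (g : X → R)
    {q M t : ℝ} (hT : (Nat.card R : ℝ) = q * M)
    (hM : (Nat.card {x : R // ¬ IsUnit x} : ℝ) = M)
    (h0 : (unitCount 0 g : ℝ) * q = Nat.card X * (q - 1) * (1 + t)) (ν : ℕ) :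
    (unitCount ν g : ℝ) * q ^ (ν + 1) =
      (q * M) ^ (2 * ν) * Nat.card X * (q - 1) * (q ^ ν + t) := by
  induction ν with
  | zero => simpa using h0
  | succ ν ih =>
    rw [unitCount_succ h2]
    push_cast
    rw [cast_natCard_isUnit hT hM, hT, hM]
    linear_combination M ^ 2 * q ^ 2 * ih

/-- The number `t` for which the proportion of unit values of the quadratic form of `Δ` is
`(1 - 1 / q) * (1 + t)`, where `q` is the order of the residue field (see `unitCount_diag`). It is
`-1`, `0`, `1 / q` for `δ = 0, 1, 2`. -/
noncomputable def deviation (q : ℝ) (δ : ℕ) : ℝ := ((δ : ℝ) - 1) * q ^ (-(δ : ℝ) / 2)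

theorem deviation_zero (q : ℝ) : deviation q 0 = -1 := by simp [deviation]

theorem deviation_one (q : ℝ) : deviation q 1 = 0 := by simp [deviation]

theorem deviation_two (q : ℝ) : deviation q 2 = q⁻¹ := by
  norm_num [deviation, Real.rpow_neg_one]

theorem natCard_isUnit_pair (R : Type*) [CommRing R] [Finite R] :
    Nat.card {v : R × R // IsUnit v.1 ∨ IsUnit v.2} +
      Nat.card {x : R // ¬ IsUnit x} ^ 2 = Nat.card R ^ 2 := by
  classical
  have := Fintype.ofFinite R
  have e : {v : R × R // ¬ (IsUnit v.1 ∨ IsUnit v.2)} ≃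
      {x : R // ¬ IsUnit x} × {x : R // ¬ IsUnit x} :=
    (Equiv.subtypeEquivRight fun v => not_or).trans 
      (Equiv.subtypeProdEquivProd (p := fun x : R => ¬ IsUnit x) (q := fun x : R => ¬ IsUnit x))
  rw [pow_two, ← Nat.card_prod, ← Nat.card_congr e, pow_two, ← Nat.card_prod]
  simp only [Nat.card_eq_fintype_card]
  rw [Fintype.card_subtype_compl, Nat.add_sub_cancel' (Fintype.card_subtype_le _)]

theorem unitCount_diag [IsLocalRing R] (h2 : IsUnit (2 : R)) (z : Rˣ) (hz : ¬ IsSquare z)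
    {q M : ℝ} (hq : q ≠ 0) (hT : (Nat.card R : ℝ) = q * M)
    (hM : (Nat.card {x : R // ¬ IsUnit x} : ℝ) = M) {δ : ℕ} (D : DeltaType δ) :
    (unitCount 0 (fun t : Fin δ → R => ∑ j, D.diag z j * (t j * t j)) : ℝ) * q =
      Nat.card (Fin δ → R) * (q - 1) * (1 + deviation q δ) := by
  rw [unitCount_zero]
  have key (c : R) (hc : IsUnit c) :
      (Nat.card {t : Fin 1 → R // IsUnit (c * (t 0 * t 0))} : ℝ) = (q - 1) * M := by
    rw [← cast_natCard_isUnit hT hM]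
    congr 1
    exact Nat.card_congr ((Equiv.funUnique (Fin 1) R).subtypeEquiv fun t => by
      simp [IsUnit.mul_iff, hc])
  rw [Nat.card_fun, Nat.card_fin]
  cases D with
  | empty => simp [deviation_zero]
  | one =>
    simp only [Fin.sum_univ_one, DeltaType.diag, Matrix.cons_val_fin_one, Nat.cast_pow,
      deviation_one, hT]
    rw [key 1 isUnit_one]
    ring
  | nonsquare =>
    simp only [Fin.sum_univ_one, DeltaType.diag, Matrix.cons_val_fin_one, Nat.cast_pow,
      deviation_one, hT]
    rw [key z z.isUnit]
    ring
  | two =>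
    have hz' : ¬ IsSquare (z : R) := by
      rintro ⟨r, hr⟩
      have hr' : IsUnit r := isUnit_of_mul_isUnit_left (hr ▸ z.isUnit)
      obtain ⟨u, rfl⟩ := hr'
      exact hz ⟨u, Units.ext hr⟩
    have e : Nat.card {t : Fin 2 → R // IsUnit (∑ j, (DeltaType.two).diag z j * (t j * t j))} =
        Nat.card {v : R × R // IsUnit v.1 ∨ IsUnit v.2} :=
      Nat.card_congr ((finTwoArrowEquiv R).subtypeEquiv fun t => by
        rw [← isUnit_sq_sub_nonsquare_iff h2 z.isUnit hz']
        simp [DeltaType.diag, finTwoArrowEquiv, sub_eq_add_neg])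
    have e' := congrArg (Nat.cast : ℕ → ℝ) (natCard_isUnit_pair R)
    push_cast at e'
    rw [hT, hM] at e'
    rw [e, deviation_two]
    push_cast
    rw [hT]
    field_simp
    linear_combination e'

end ClosedForms

/-! ### Pairs of nonadjacent vertices in the standard graph -/

section Examples

variable {R : Type*} [CommRing R] {ν δ : ℕ}

theorem form_single_single {ι : Type*} [Fintype ι] [DecidableEq ι] (S : Matrix ι ι R) (i j : ι) :
    form S (Pi.single i 1) (Pi.single j 1) = S i j := by
  simp [form]

/-- The vector of the standard basis with index `i` in the first block. -/
def stdE (δ : ℕ) (i : Fin ν) : (Fin ν ⊕ Fin ν) ⊕ Fin δ → R := Pi.single (.inl (.inl i)) 1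

/-- The vector of the standard basis with index `i` in the second block. -/
def stdF (δ : ℕ) (i : Fin ν) : (Fin ν ⊕ Fin ν) ⊕ Fin δ → R := Pi.single (.inl (.inr i)) 1

variable (z : Rˣ) (D : DeltaType δ)

theorem form_stdE_stdE (i j : Fin ν) : form (formMatrix ν z D) (stdE δ i) (stdE δ j) = 0 := by
  simp [stdE, form_single_single, formMatrix]

theorem form_stdF_stdF (i j : Fin ν) : form (formMatrix ν z D) (stdF δ i) (stdF δ j) = 0 := by
  simp [stdF, form_single_single, formMatrix]

theorem form_stdE_stdF (i j : Fin ν) :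
    form (formMatrix ν z D) (stdE δ i) (stdF δ j) = if i = j then 1 else 0 := by
  simp [stdE, stdF, form_single_single, formMatrix, Matrix.one_apply]

theorem isHyperbolicPair_std (i : Fin ν) :
    IsHyperbolicPair (formMatrix ν z D) (stdE δ i) (stdF δ i) :=
  ⟨form_stdE_stdE z D i i, form_stdF_stdF z D i i, by simp [form_stdE_stdF]⟩

theorem isUnit_stdE (i : Fin ν) : ∃ j, IsUnit (stdE (R := R) δ i j) :=
  ⟨.inl (.inl i), by simp [stdE]⟩

variable {i j : Fin ν}

theorem not_isClose_std [Nontrivial R] (hij : i ≠ j) :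
    ¬ IsClose (formMatrix ν z D) (stdE δ i) (stdF δ i) (stdE δ j) := by
  rintro ⟨-, h⟩
  refine h ⟨stdF δ j, ?_, form_stdF_stdF z D i j⟩ ?_
  · rw [form_stdE_stdF, if_neg hij]
  · rw [form_stdE_stdF, if_pos rfl]
    exact isUnit_one

/-- The isotropic vector `e_i + r e_j`, which for a nonzero nonunit `r` represents a vertex
different from `e_i` but equal to it modulo the maximal ideal. -/
def stdEAdd (δ : ℕ) (i j : Fin ν) (r : R) : (Fin ν ⊕ Fin ν) ⊕ Fin δ → R :=
  stdE δ i + r • stdE δ j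

theorem form_stdEAdd_self (r : R) :
    form (formMatrix ν z D) (stdEAdd δ i j r) (stdEAdd δ i j r) = 0 := by
  simp [stdEAdd, form_add_left, form_add_right, form_smul_left, form_smul_right, form_stdE_stdE]

theorem isUnit_stdEAdd (hij : i ≠ j) (r : R) : ∃ l, IsUnit (stdEAdd δ i j r l) :=
  ⟨.inl (.inl i), by simp [stdEAdd, stdE, hij]⟩

theorem isClose_stdEAdd [Nontrivial R] {r : R} (hr : ¬ IsUnit r) :
    IsClose (formMatrix ν z D) (stdE δ i) (stdF δ i) (stdEAdd δ i j r) := by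
  constructor
  · simp [stdEAdd, form_add_right, form_smul_right, form_stdE_stdE]
  · intro w
    rw [stdEAdd, form_add_left, form_left_perp, zero_add, form_smul_left]
    exact not_isUnit_mul hr

theorem mkVertex_ne_stdEAdd (hij : i ≠ j) {r : R} (hr : r ≠ 0) :
    mkVertex (stdE δ i) (isUnit_stdE i) (form_stdE_stdE z D i i) ≠
      mkVertex (stdEAdd δ i j r) (isUnit_stdEAdd hij r) (form_stdEAdd_self z D r) := by
  intro h
  obtain ⟨u, hu⟩ := mkVertex_eq_iff.mp h
  have := congrFun hu (.inl (.inl j))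
  simp only [stdE, stdEAdd, Pi.single_apply, Pi.smul_apply, Pi.add_apply, smul_eq_mul, Sum.inl.injEq,
    hij.symm, if_true, if_false, mul_one, zero_add] at this
  exact hr (u.mul_right_eq_zero.mp this.symm)

theorem mkVertex_stdE_ne [Nontrivial R] (hij : i ≠ j) :
    mkVertex (stdE δ i) (isUnit_stdE i) (form_stdE_stdE z D i i) ≠
      mkVertex (stdE δ j) (isUnit_stdE j) (form_stdE_stdE z D j j) := by
  intro h
  obtain ⟨u, hu⟩ := mkVertex_eq_iff.mp h
  have := congrFun hu (.inl (.inl i))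
  simp [stdE, hij] at this

end Examples

/-! ### Evaluation of the parameters -/

theorem deviation_mul_pow {q : ℝ} (hq : 0 < q) (μ δ : ℕ) :
    ((δ : ℝ) - 1) * q ^ (-(μ : ℝ) - (δ : ℝ) / 2) = deviation q δ / q ^ μ := by
  rw [show -(μ : ℝ) - (δ : ℝ) / 2 = -(δ : ℝ) / 2 - μ by ring, Real.rpow_sub hq,
    Real.rpow_natCast, deviation, mul_div_assoc]

/-- The number of common neighbours of adjacent vertices, from the closed form of the number of
unit values. -/
theorem lambda_closed {p m s μ δ : ℕ} (hp : 1 < p) {l : ℝ}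
    (hl : l * ((p : ℝ) ^ m) ^ (μ + 1) = (((p : ℝ) ^ m) ^ s) ^ (2 * μ + δ) * ((p : ℝ) ^ m - 1) *
      (((p : ℝ) ^ m) ^ μ + deviation ((p : ℝ) ^ m) δ)) :
    l = ((p : ℝ) ^ m - 1)
        * (1 + ((δ : ℝ) - 1) * (p : ℝ) ^ ((m : ℝ) * (1 - ((μ + 1 : ℕ) : ℝ) - (δ : ℝ) / 2)))
        * (p : ℝ) ^ ((m : ℝ) * (2 * (s : ℝ) * ((μ + 1 : ℕ) : ℝ) - 2 * (s : ℝ) - 1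
          + (s : ℝ) * (δ : ℝ))) := by
  have hp0 : (0 : ℝ) < p := by exact_mod_cast (by lia : 0 < p)
  rw [Real.rpow_mul hp0.le, Real.rpow_mul hp0.le, Real.rpow_natCast]
  have hq : (0 : ℝ) < (p : ℝ) ^ m := by positivity
  generalize (p : ℝ) ^ m = q at *
  rw [show (1 : ℝ) - ((μ + 1 : ℕ) : ℝ) - (δ : ℝ) / 2 = -(μ : ℝ) - (δ : ℝ) / 2 by push_cast; ring,
    deviation_mul_pow hq,
    show 2 * (s : ℝ) * ((μ + 1 : ℕ) : ℝ) - 2 * (s : ℝ) - 1 + (s : ℝ) * (δ : ℝ) =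
      ((s * (2 * μ + δ) : ℕ) : ℝ) - 1 by push_cast; ring,
    Real.rpow_sub hq, Real.rpow_natCast, Real.rpow_one, pow_mul]
  rw [← mul_left_inj' (pow_pos hq (μ + 1)).ne', hl]
  field_simp
  ring

/-- The number of vertices, from the count of paths of length two. -/
theorem card_closed {q n k l C r : ℝ} {δ : ℕ} (D : DeltaType δ) (hq : 1 < q) {s μ : ℕ}
    (hs : 1 ≤ s) (hk : k = (q ^ s) ^ (2 * μ + δ)) (hC : C = (q ^ (s - 1)) ^ (2 * μ + δ))
    (hl : l * q ^ (μ + 1) = k * (q - 1) * (q ^ μ + deviation q δ))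
    (hn : n = k + C + r) (hr : k * k * q = k * l * q + C * k * q + r * (k * (q - 1))) :
    n = (q ^ (μ + 1) - 1) * (q ^ (μ + 1 + δ - 1) + 1) * C / (q - 1) := by
  have hq0 : 0 < q := by linarith
  have hk0 : k ≠ 0 := by rw [hk]; positivity
  -- over the residue field the valency is `q ^ (2 * μ + δ)`, and reduction is `C` to one on
  -- neighbours
  have hkC : k = q ^ (2 * μ + δ) * C := by
    rw [hk, hC, ← mul_pow, ← pow_succ', Nat.sub_add_cancel hs]
  have hr' : k * q = l * q + C * q + r * (q - 1) := mul_left_cancel₀ hk0 (by linear_combination hr)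
  rw [eq_div_iff (by linarith)]
  refine mul_right_cancel₀ (pow_pos hq0 μ).ne' ?_
  have h1 : n * (q - 1) * q ^ μ =
      (k + C) * (q - 1) * q ^ μ + q ^ (μ + 1) * (k - C) - k * (q - 1) * (q ^ μ + deviation q δ) := by
    rw [hn]
    linear_combination -q ^ μ * hr' - hl
  rw [h1, hkC]
  have h2 : μ + 1 + δ - 1 = μ + δ := by lia
  rw [h2]
  cases D with
  | empty => rw [deviation_zero]; ring
  | one => rw [deviation_one]; ring
  | nonsquare => rw [deviation_one]; ring
  | two =>
    rw [deviation_two]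
    field_simp
    ring

end OrthGraph

open OrthGraph

theorem theorem4p4 (p s m : ℕ) (hp : p.Prime) (hp_odd : Odd p) (hs : 1 ≤ s) (hm : 1 ≤ m)
    (R : Type*) [CommRing R] [Nontrivial R] (hR : OrthGraph.IsGaloisRing p s m R)
    (z : Rˣ) (hz : ¬ IsSquare z)
    (ν δ : ℕ) (hν : 2 ≤ ν) (D : OrthGraph.DeltaType δ) :
    ∃ n k l c₁ c₂ : ℕ,
      (n : ℝ) = ((p : ℝ) ^ (m * ν) - 1) * ((p : ℝ) ^ (m * (ν + δ - 1)) + 1)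
        * (p : ℝ) ^ (m * (s - 1) * (2 * ν - 2 + δ)) / ((p : ℝ) ^ m - 1) ∧
      k = p ^ (m * s * (2 * ν - 2 + δ)) ∧
      (l : ℝ) = ((p : ℝ) ^ m - 1)
        * (1 + ((δ : ℝ) - 1) * (p : ℝ) ^ ((m : ℝ) * (1 - (ν : ℝ) - (δ : ℝ) / 2)))
        * (p : ℝ) ^ ((m : ℝ) * (2 * (s : ℝ) * (ν : ℝ) - 2 * (s : ℝ) - 1 + (s : ℝ) * (δ : ℝ))) ∧
      c₁ = (p ^ m - 1) * p ^ (m * (s * (2 * ν - 2 + δ) - 1)) ∧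
      c₂ = p ^ (m * s * (2 * ν - 2 + δ)) ∧
      OrthGraph.IsQuasiStronglyRegular (OrthGraph.orthogonalGraph ν z D) n k l ![c₁, c₂] ∧
      (2 ≤ s → ∀ c ∈ ({c₁, c₂} : Set ℕ), ∃ v w, v ≠ w ∧
        ¬ (OrthGraph.orthogonalGraph ν z D).Adj v w ∧
        ((OrthGraph.orthogonalGraph ν z D).commonNeighbors v w).ncard = c) := by
  have := hR.finite
  have := hR.isLocalRing
  have h2 := hR.isUnit_two hp_odd
  have hp1 := hp.one_lt
  obtain ⟨S', hS'⟩ := exists_formMatrix_mul_eq_one ν z D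
  have hS := formMatrix_isSymm ν z D
  obtain ⟨μ, rfl⟩ : ∃ μ, ν = μ + 1 := ⟨ν - 1, by lia⟩
  have hμ : 1 ≤ μ := by lia
  set g : (Fin δ → R) → R := fun t => ∑ j, D.diag z j * (t j * t j)
  have hexp : 2 * (μ + 1) - 2 + δ = 2 * μ + δ := by lia
  rw [hexp]
  have hqp : 1 < p ^ m := Nat.one_lt_pow (by lia) hp1
  have hT : Nat.card R = (p ^ m) ^ s := by rw [hR.card_eq, mul_comm, pow_mul]
  have hM : Nat.card {x : R // ¬ IsUnit x} = (p ^ m) ^ (s - 1) := hR.card_nonunits hp1 hs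
  have hTM : (p ^ m) ^ s = (p ^ m) * (p ^ m) ^ (s - 1) := by
    rw [← pow_succ', Nat.sub_add_cancel hs]
  have hU : Nat.card {x : R // IsUnit x} = (p ^ m - 1) * (p ^ m) ^ (s - 1) := by
    have := natCard_isUnit_add R
    rw [hT, hM, hTM] at this
    rw [Nat.sub_one_mul]
    lia
  have hcard : Fintype.card ((Fin (μ + 1) ⊕ Fin (μ + 1)) ⊕ Fin δ) = 2 + (2 * μ + δ) := by
    simp only [Fintype.card_sum, Fintype.card_fin]
    ring
  have hk_pow : p ^ (m * s * (2 * μ + δ)) = ((p ^ m) ^ s) ^ (2 * μ + δ) := by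
    rw [pow_mul, pow_mul]
  have hk : Nat.card R ^ 2 * ((p ^ m) ^ s) ^ (2 * μ + δ) =
      Nat.card R ^ Fintype.card ((Fin (μ + 1) ⊕ Fin (μ + 1)) ⊕ Fin δ) := by
    rw [hcard, hT, ← pow_add]
  have hC : Nat.card {x : R // ¬ IsUnit x} ^ 2 * ((p ^ m) ^ (s - 1)) ^ (2 * μ + δ) =
      Nat.card {x : R // ¬ IsUnit x} ^ Fintype.card ((Fin (μ + 1) ⊕ Fin (μ + 1)) ⊕ Fin δ) := by
    rw [hcard, hM, ← pow_add]
  have hl : Nat.card {v : (Fin (μ + 1) ⊕ Fin (μ + 1)) ⊕ Fin δ → R //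
        IsUnit (form (formMatrix (μ + 1) z D) v v)} =
      Nat.card {x : R // IsUnit x} ^ 2 * ((p ^ m) ^ s) ^ (2 * μ + δ) +
        Nat.card {x : R // ¬ IsUnit x} * Nat.card R * unitCount μ g := by
    rw [natCard_isUnit_formMatrix, unitCount_succ h2, Nat.card_fun, Nat.card_fin, ← pow_add, ← hT]
  set k := ((p ^ m) ^ s) ^ (2 * μ + δ) with hk_def
  set c := (p ^ m - 1) * p ^ (m * (s * (2 * μ + δ) - 1)) with hc_def
  have hcq : c * p ^ m = k * (p ^ m - 1) := by
    have h1 : 1 ≤ s * (2 * μ + δ) := Nat.mul_pos hs (by lia)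
    rw [hc_def, hk_def, mul_assoc, ← pow_add, ← pow_mul, ← pow_mul, mul_comm,
      show m * (s * (2 * μ + δ) - 1) + m = m * s * (2 * μ + δ) by
        obtain ⟨e, he⟩ : ∃ e, s * (2 * μ + δ) = e + 1 := ⟨_, (Nat.sub_add_cancel h1).symm⟩
        rw [mul_assoc, he, Nat.add_sub_cancel]
        ring, mul_assoc]
  have hc : c * Nat.card R = k * Nat.card {x : R // IsUnit x} := by
    rw [hT, hU, hTM, ← mul_assoc, ← mul_assoc, hcq]
  have hk0 : 0 < k := by positivity
  have hc0 : 0 < c := Nat.mul_pos (by lia) (by positivity)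
  have hck : c < k := by
    by_contra! h
    have h1 := Nat.mul_le_mul_right (p ^ m) h
    rw [hcq] at h1
    exact absurd (Nat.le_of_mul_le_mul_left h1 hk0) (by lia)
  let i : Fin (μ + 1) := 0
  let j : Fin (μ + 1) := Fin.last μ
  have hij : i ≠ j := by
    simp only [i, j, Ne, Fin.ext_iff, Fin.val_zero, Fin.val_last]
    lia
  let x := mkVertex (stdE δ i) (isUnit_stdE i) (form_stdE_stdE z D i i)
  obtain ⟨r, hr1, hr2⟩ := exists_card_vertices hS h2 hS' hk hl hc hC x
  have hTR : (Nat.card R : ℝ) = (p : ℝ) ^ m * ((p : ℝ) ^ m) ^ (s - 1) := by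
    rw [hT, hTM]; push_cast; rfl
  have hMR : (Nat.card {x : R // ¬ IsUnit x} : ℝ) = ((p : ℝ) ^ m) ^ (s - 1) := by
    rw [hM]; push_cast; rfl
  have hqR : (1 : ℝ) < (p : ℝ) ^ m := by exact_mod_cast hqp
  have hkR : (k : ℝ) = (((p : ℝ) ^ m) ^ s) ^ (2 * μ + δ) := by
    rw [hk_def]; push_cast; rfl
  have hlR : (unitCount μ g : ℝ) * ((p : ℝ) ^ m) ^ (μ + 1) =
      (k : ℝ) * ((p : ℝ) ^ m - 1) * (((p : ℝ) ^ m) ^ μ + deviation ((p : ℝ) ^ m) δ) := by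
    rw [unitCount_closed h2 g hTR hMR
      (unitCount_diag h2 z hz (by positivity) hTR hMR D) μ, Nat.card_fun, Nat.card_fin, hkR,
      ← hTR, hT]
    push_cast
    rw [pow_add]
  have hconn : (orthogonalGraph (μ + 1) z D).Connected := by
    have : Nonempty {x : ProjPoint R ((Fin (μ + 1) ⊕ Fin (μ + 1)) ⊕ Fin δ) //
      x.IsIsotropic (formMatrix (μ + 1) z D)} := ⟨x⟩
    refine ⟨fun v w => ?_⟩
    by_cases hvw : (orthogonalGraph (μ + 1) z D).Adj v w
    · exact hvw.reachable
    · have h := ncard_commonNeighbors_of_not_adj hS h2 hS' hk hc hvw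
      have hpos : 0 < ((isotropicGraph _ hS).commonNeighbors v w).ncard := by lia
      obtain ⟨y, hy1, hy2⟩ := Set.nonempty_of_ncard_ne_zero hpos.ne'
      exact (SimpleGraph.Adj.reachable (G := isotropicGraph _ hS) hy1).trans
        (SimpleGraph.Adj.reachable (G := isotropicGraph _ hS) hy2).symm
  refine ⟨_, k, unitCount μ g, c, k, ?_, hk_pow.symm, ?_, rfl, hk_pow.symm,
    ⟨?_, inferInstance, hconn, rfl, ncard_neighborSet_eq hS h2 hS' hk,
      fun v w => ncard_commonNeighbors_of_adj_eq hS h2 hk hl, fun v w _ hvw => ?_⟩, ?_⟩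
  · have h := card_closed D hqR hs hkR rfl hlR
      (show (Nat.card {x : ProjPoint R ((Fin (μ + 1) ⊕ Fin (μ + 1)) ⊕ Fin δ) //
        x.IsIsotropic (formMatrix (μ + 1) z D)} : ℝ) = _ by rw [hr1]; push_cast; rfl) ?_
    · rw [h, pow_mul, pow_mul, pow_mul, pow_mul]
    · have hr2R := congrArg (Nat.cast : ℕ → ℝ) hr2
      have hcqR := congrArg (Nat.cast : ℕ → ℝ) hcq
      push_cast [Nat.cast_sub hqp.le] at hr2R hcqR
      linear_combination (p : ℝ) ^ m * hr2R + (r : ℝ) * hcqR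
  · exact lambda_closed hp1 (by rw [hlR, hkR])
  · intro a b hab
    fin_cases a <;> fin_cases b <;> simp_all
  · rcases ncard_commonNeighbors_of_not_adj hS h2 hS' hk hc hvw with h | h
    · exact ⟨0, h⟩
    · exact ⟨1, h⟩
  -- `e_i` and `e_j` give the first value, `e_i` and `e_i + p e_j` the second one; `p ≠ 0` as `2 ≤ s`
  · rintro hs2 c' (rfl | rfl)
    · have hadj : ¬ IsUnit (form (formMatrix (μ + 1) z D) (stdE δ i) (stdE δ j)) := by
        rw [form_stdE_stdE]
        exact not_isUnit_zero
      exact ⟨x, mkVertex (stdE δ j) (isUnit_stdE j) (form_stdE_stdE z D j j),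
        mkVertex_stdE_ne z D hij, hadj,
        ncard_commonNeighbors_of_not_isClose_eq hS h2 hk hc (isHyperbolicPair_std z D i) hadj
          (not_isClose_std z D hij)⟩
    · have hp0 : (p : R) ≠ 0 := by simpa using hR.pow_ne_zero hp1 (i := 1) (by lia)
      have hpu : ¬ IsUnit (p : R) := by rw [hR.isUnit_iff, not_not]
      have hclose := isClose_stdEAdd z D (i := i) (j := j) hpu
      exact ⟨x, mkVertex (stdEAdd δ i j (p : R)) (isUnit_stdEAdd hij _)
        (form_stdEAdd_self z D _), mkVertex_ne_stdEAdd z D hij hp0, hclose.1,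
        ncard_commonNeighbors_of_isClose_eq hS h2 hS' hk (isHyperbolicPair_std z D i) hclose⟩
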